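/- **Theorem (consistency of the $P^2$ semi-Lagrangian discontinuous Galerkin scheme).** Let $\Omega\subset\mathbb R^2$ be a bounded open set, $T\in\mathbb R$, and let $u,a,b$ be $C^\infty$ on a neighbourhood of $\overline\Omega\times[0,T]$ with $$u_t+(a\,u)_x+(b\,u)_y=0\qquad\text{on }\Omega\times[0,T].$$ Let $\sigma,c_1>0$ and $c_2,\kappa,C_0\in\mathbb R$. Then there are constants $C,h_0>0$, depending only on these data, such that the following holds. *Mesh.* Let $K_1,\dots,K_J\subset\overline\Omega$ be nondegenerate closed triangles with pairwise disjoint interiors (for example a triangulation of $\overline\Omega$), and put $h=\max_j\operatorname{diam}K_j\le h_0$. Assume that every $K_j$ contains a disc of radius $\sigma h$. Let $V_h^2$ be the space of functions whose restriction to each $K_j$ lies in $P^2(K_j)$, the polynomials of total degree at most $2$. Let $t^n\ge 0$, $t^{n+1}=t^n+\Delta t\le T$ and $c_1h\le\Delta t\le c_2h$. *Tracing.* For each $j$ let $v_1,v_2,v_3$ be the vertices of $K_j$, $v_4,v_5,v_6$ the midpoints of the edges $v_1v_2$, $v_2v_3$, $v_1v_3$, and $v_7$ the barycenter. Let $v_q^\star=\Phi(v_q)$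 be obtained from a map $\Phi$ that approximates the backward characteristics: whenever $(x(t),y(t))$ solves $x'=a(x,y,t)$, $y'=b(x,y,t)$ on $[t^n,t^{n+1}]$, stays in $\overline\Omega$ and equals $v_q$ at time $t^{n+1}$, then $|v_q^\star-(x(t^n),y(t^n))|\le\kappa\,\Delta t^3$ (exact tracing and Runge–Kutta tracing of order at least two are included). *Upstream element and test functions.* Let $K_j^\star$ be the quadratic-curvilinear triangle $\{\sum_{i=1}^6N_i(\xi,\eta)\,v_i^\star:\ \xi,\eta\ge0,\ \xi+\eta\le1\}$, where $N_1=1-3\xi-3\eta+2\xi^2+4\xi\eta+2\eta^2$, $N_2=2\xi^2-\xi$, $N_3=2\eta^2-\eta$, $N_4=4\xi-4\xi\eta-4\xi^2$, $N_5=4\xi\eta$, $N_6=4\eta-4\xi\eta-4\eta^2$. For $\Psi\in P^2$ let $\psi^\star\in P^2$ be a least-squares fit, i.e. a minimizer of $\sum_{q=1}^7\bigl(\psi^\star(v_q^\star)-\Psi(v_q)\bigr)^2$ over $P^2$. *Claim.* Let $u^n\in V_h^2$ be a third-order approximation of the exact solution at $t^n$, in the sense that $\|u^n-u(\cdot,t^n)\|_{L^2(K_l)}\le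 C_0h^3$ for all $l$. Then there is $u^{n+1}\in V_h^2$ such that, for every $j$ for which all points of $K_j$ at time $t^{n+1}$ are reached by characteristics that stay in $\overline\Omega$ on $[t^n,t^{n+1}]$ and for which $K_j^\star\subset\bigcup_lK_l$ (so that no boundary data enter), $u^{n+1}|_{K_j}$ is the unique element of $P^2(K_j)$ with $$\int_{K_j}u^{n+1}\,\Psi\,dx\,dy=\int_{K_j^\star}u^n\,\psi^\star\,dx\,dy=\sum_{l}\int_{K_j^\star\cap K_l}u^n\,\psi^\star\,dx\,dy$$ for all $\Psi\in P^2(K_j)$ and all least-squares fits $\psi^\star$ belonging to $\Psi$, and $$\|u^{n+1}-u(\cdot,t^{n+1})\|_{L^2(K_j)}\le C\,h^3 .$$ -/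

import Mathlib

open MeasureTheory Set
open scoped ContDiff

noncomputable section

namespace SLDG

/-- The plane with its Euclidean norm and Lebesgue measure. -/
abbrev Plane := EuclideanSpace ℝ (Fin 2)

/-! ### The transport equation and its characteristics -/

/-- `f` is `C^∞` up to the boundary of the cylinder `closure Ω × [0, T]`: it is smooth on some open
neighbourhood of that cylinder. -/
def SmoothOnCylinder (Ω : Set Plane) (T : ℝ) (f : Plane × ℝ → ℝ) : Prop :=
  ∃ U : Set (Plane × ℝ), IsOpen U ∧ closure Ω ×ˢ Icc 0 T ⊆ U ∧ ContDiffOn ℝ ∞ f U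

/-- The equation `u_t + (a u)_x + (b u)_y = 0` on `Ω × [0, T]`. -/
def SolvesTransport (Ω : Set Plane) (T : ℝ) (a b u : Plane × ℝ → ℝ) : Prop :=
  ∀ x ∈ Ω, ∀ t ∈ Icc 0 T,
    deriv (fun s => u (x, s)) t
      + lineDeriv ℝ (fun y => a (y, t) * u (y, t)) x (EuclideanSpace.single 0 1)
      + lineDeriv ℝ (fun y => b (y, t) * u (y, t)) x (EuclideanSpace.single 1 1) = 0

/-- `γ` is a characteristic curve on the time interval `[s, t]` that stays in `closure Ω`. -/
def IsCharacteristic (Ω : Set Plane) (a b : Plane × ℝ → ℝ) (s t : ℝ) (γ : ℝ → Plane) : Prop :=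
  ∀ τ ∈ Icc s t, γ τ ∈ closure Ω ∧
    HasDerivWithinAt γ !₂[a (γ τ, τ), b (γ τ, τ)] (Icc s t) τ

/-- `y` is the exact foot at time `s` of the characteristic in `closure Ω` that arrives at `x` at
time `t`. -/
def IsFoot (Ω : Set Plane) (a b : Plane × ℝ → ℝ) (s t : ℝ) (x y : Plane) : Prop :=
  ∃ γ : ℝ → Plane, IsCharacteristic Ω a b s t γ ∧ γ t = x ∧ γ s = y

/-! ### Triangular meshes and discontinuous piecewise polynomials -/

/-- The closed triangle with the three given vertices. -/
def triangle (v : Fin 3 → Plane) : Set Plane := convexHull ℝ (range v)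

/-- Finitely many nondegenerate closed triangles with pairwise disjoint interiors (conforming
triangulations are a special case). -/
structure TriMesh (J : ℕ) where
  vert : Fin J → Fin 3 → Plane
  nondegenerate : ∀ j, AffineIndependent ℝ (vert j)
  nonoverlapping : Pairwise fun i j =>
    Disjoint (interior (triangle (vert i))) (interior (triangle (vert j)))

/-- Polynomials in two variables of total degree at most `k`. -/
abbrev Poly (k : ℕ) : Type := MvPolynomial.restrictTotalDegree (Fin 2) ℝ k

/-- The value of a polynomial at a point of the plane. -/
def pval {k : ℕ} (p : Poly k) (x : Plane) : ℝ :=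
  MvPolynomial.eval (fun i => x i) (p : MvPolynomial (Fin 2) ℝ)

namespace TriMesh

variable {J : ℕ} (M : TriMesh J)

/-- The element `K_j`. -/
def cell (j : Fin J) : Set Plane := triangle (M.vert j)

/-- The region covered by the mesh. -/
def region : Set Plane := ⋃ j, M.cell j

/-- The mesh size `h = max_j diam K_j`. -/
def size : ℝ := ⨆ j, Metric.diam (M.cell j)

/-- Shape regularity and quasi-uniformity with constant `σ`: every element contains a disc of
radius `σ h` (and has diameter at most `h` by the definition of `h`). -/
def IsQuasiUniform (σ : ℝ) : Prop :=
  ∀ j, ∃ c : Plane, Metric.closedBall c (σ * M.size) ⊆ M.cell j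

/-- The space `V_h^k`: one polynomial of degree at most `k` for each element. -/
abbrev DGSpace (_M : TriMesh J) (k : ℕ) := Fin J → Poly k

/-- The seven points of `K_j` that are traced back: three vertices, three edge midpoints (in the
order of the TRIA6 element) and the barycenter. -/
def node (j : Fin J) : Fin 7 → Plane :=
  ![M.vert j 0, M.vert j 1, M.vert j 2,
    midpoint ℝ (M.vert j 0) (M.vert j 1),
    midpoint ℝ (M.vert j 1) (M.vert j 2),
    midpoint ℝ (M.vert j 0) (M.vert j 2),
    (1 / 3 : ℝ) • (M.vert j 0 + M.vert j 1 + M.vert j 2)]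

end TriMesh

/-! ### The quadratic isoparametric element TRIA6 -/

/-- The closed reference triangle. -/
def refTriangle : Set (ℝ × ℝ) := {ξ | 0 ≤ ξ.1 ∧ 0 ≤ ξ.2 ∧ ξ.1 + ξ.2 ≤ 1}

/-- The six quadratic shape functions. -/
def shape (ξ η : ℝ) : Fin 6 → ℝ :=
  ![-3 * ξ + 2 * ξ ^ 2 - 3 * η + 2 * η ^ 2 + 4 * ξ * η + 1,
    -ξ + 2 * ξ ^ 2,
    -η + 2 * η ^ 2,
    4 * ξ - 4 * ξ * η - 4 * ξ ^ 2,
    4 * ξ * η,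
    4 * η - 4 * ξ * η - 4 * η ^ 2]

/-- The isoparametric map with control points `w`. -/
def isoMap (w : Fin 6 → Plane) (ξ : ℝ × ℝ) : Plane := ∑ i, shape ξ.1 ξ.2 i • w i

/-! ### One step of the scheme -/

section Scheme

variable {J : ℕ} (M : TriMesh J)

/-- The upstream element `K_j^⋆`: the quadratic-curvilinear triangle through the traced nodes
`Φ (v_1), …, Φ (v_6)`, where `Φ` is the (numerical) backward tracing of points. -/
def upstream (Φ : Plane → Plane) (j : Fin J) : Set Plane :=
  isoMap (fun i : Fin 6 => Φ (M.node j i.castSucc)) '' refTriangle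

/-- `ψ` is a least-squares fit in `P^2` at the seven traced points to the values of `Ψ` at the
original points. -/
def IsLeastSquaresFit (Φ : Plane → Plane) (j : Fin J) (Ψ ψ : Poly 2) : Prop :=
  ∀ χ : Poly 2,
    ∑ q, (pval ψ (Φ (M.node j q)) - pval Ψ (M.node j q)) ^ 2
      ≤ ∑ q, (pval χ (Φ (M.node j q)) - pval Ψ (M.node j q)) ^ 2

/-- The integral of `v ψ` over `S ∩ region`, `v ∈ V_h^2`, as the sum over the overlaps of `S` with
the elements of the background mesh. -/
def remapIntegral (S : Set Plane) (v : M.DGSpace 2) (ψ : Poly 2) : ℝ :=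
  ∑ l, ∫ x in S ∩ M.cell l, pval (v l) x * pval ψ x

/-- The polynomial `p` is the restriction to `K_j` of the result of one step of the `P^2` scheme
from `uOld`: `∫_{K_j} p Ψ = ∫_{K_j^⋆} uOld ψ^⋆` for all `Ψ ∈ P^2`, with `ψ^⋆` the least-squares
reconstruction that belongs to `Ψ`. -/
def IsUpdate (Φ : Plane → Plane) (uOld : M.DGSpace 2) (j : Fin J) (p : Poly 2) : Prop :=
  ∀ Ψ ψ : Poly 2, IsLeastSquaresFit M Φ j Ψ ψ →
    ∫ x in M.cell j, pval p x * pval Ψ x = remapIntegral M (upstream M Φ j) uOld ψ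

/-- The tracing `Φ` from time `t` back to time `s` has error at most `κ (t - s)^3` at the points
that are traced (exact tracing, and every one-step method of order at least two). -/
def TracingAccurate (Ω : Set Plane) (a b : Plane × ℝ → ℝ) (s t κ : ℝ) (Φ : Plane → Plane) : Prop :=
  ∀ j q y, IsFoot Ω a b s t (M.node j q) y → dist (Φ (M.node j q)) y ≤ κ * (t - s) ^ 3

/-- The upstream data of `K_j` lie in the domain, so that no boundary data enter: all
characteristics that end in `K_j` run in `closure Ω`, and `K_j^⋆` is covered by the mesh. -/
def UpstreamInside (Ω : Set Plane) (a b : Plane × ℝ → ℝ) (s t : ℝ) (Φ : Plane → Plane)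
    (j : Fin J) : Prop :=
  (∀ x ∈ M.cell j, ∃ y, IsFoot Ω a b s t x y) ∧ upstream M Φ j ⊆ M.region

/-- The `L^2(K_j)` norm of `p - f`. -/
def cellError (j : Fin J) (p : Poly 2) (f : Plane → ℝ) : ENNReal :=
  eLpNorm (fun x => pval p x - f x) 2 (volume.restrict (M.cell j))

end Scheme

end SLDG

end

/-!
Expand about `(x₀, tⁿ⁺¹)`, where `x₀` is a vertex of `K_j`. Up to `O(h³)` the backward flow over one
step is an affine map with linear part `L = id - Δt ∇(a, b)`, so that in the coordinates `ξ` of the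
reference triangle the traced points are the images under `ξ ↦ w + L B ξ` of the nodes displaced by
only `O(h²)`; here `B` is the linear part of the parametrization of `K_j`. Hence `K_j^⋆` is the
affine image of a slightly perturbed reference triangle, and `ψ^⋆`, in these coordinates, agrees
with `Ψ` up to `O(h²)` times the largest nodal value `m` of `Ψ`. Pulling both integrals back to the
reference triangle, what `u` loses along characteristics and the change of area cancel up to `O(h²)`
by the transport equation, so `∫_{K_j^⋆} u(tⁿ) ψ^⋆ - ∫_{K_j} u(tⁿ⁺¹) Ψ = O(h² |det B| m)`. The error
of `uⁿ` contributes a term of the same size, by Cauchy-Schwarz on each of the boundedly many cells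
that meet `K_j^⋆`. Thus the moments of `uⁿ⁺¹` and `u(tⁿ⁺¹)` agree to second order, and testing with
the difference of `uⁿ⁺¹` and a Taylor polynomial of `u` turns this into a pointwise bound `O(h²)`,
that is, `O(h³)` in `L²(K_j)`.
-/

noncomputable section

namespace SLDG

/-! ### Polynomials on the plane -/

section Poly

variable {k : ℕ}

@[simp] lemma pval_add (p q : Poly k) (x : Plane) : pval (p + q) x = pval p x + pval q x := by
  simp [pval]

@[simp] lemma pval_sub (p q : Poly k) (x : Plane) : pval (p - q) x = pval p x - pval q x := by
  simp [pval]

@[simp] lemma pval_smul (r : ℝ) (p : Poly k) (x : Plane) : pval (r • p) x = r * pval p x := by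
  simp [pval, MvPolynomial.smul_eval]

@[simp] lemma pval_zero (x : Plane) : pval (0 : Poly k) x = 0 := by
  simp [pval]

lemma pval_injective : Function.Injective (pval : Poly k → Plane → ℝ) := fun p q h =>
  Subtype.ext <| MvPolynomial.funext fun x => by simpa [pval] using congrFun h (WithLp.toLp 2 x)

@[fun_prop]
lemma continuous_pval (p : Poly k) : Continuous (pval p) := by
  unfold pval
  exact (MvPolynomial.continuous_eval _).comp (PiLp.continuous_ofLp 2 _)

/-- The affine function `x ↦ r + φ x` as a polynomial. -/
def affinePoly (r : ℝ) (φ : Plane →L[ℝ] ℝ) : MvPolynomial (Fin 2) ℝ :=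
  MvPolynomial.C r
    + ∑ i, MvPolynomial.C (φ (EuclideanSpace.single i 1)) * MvPolynomial.X i

lemma plane_eq_sum (x : Plane) : x = ∑ i, x i • EuclideanSpace.single i 1 := by
  ext i
  fin_cases i <;> simp

lemma eval_affinePoly (r : ℝ) (φ : Plane →L[ℝ] ℝ) (x : Plane) :
    MvPolynomial.eval (fun i => x i) (affinePoly r φ) = r + φ x := by
  conv_rhs => rw [plane_eq_sum x, map_sum]
  simp [affinePoly, mul_comm]

lemma totalDegree_affinePoly_le (r : ℝ) (φ : Plane →L[ℝ] ℝ) :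
    (affinePoly r φ).totalDegree ≤ 1 := by
  refine (MvPolynomial.totalDegree_add _ _).trans (max_le (by simp) ?_)
  refine MvPolynomial.totalDegree_finsetSum_le fun i _ => ?_
  exact (MvPolynomial.totalDegree_mul _ _).trans (by simp)

lemma exists_pval_eq_affine (hk : 1 ≤ k) (r : ℝ) (φ : Plane →L[ℝ] ℝ) (x₀ : Plane) :
    ∃ p : Poly k, ∀ x, pval p x = r + φ (x - x₀) := by
  refine ⟨⟨affinePoly (r - φ x₀) φ, ?_⟩, fun x => ?_⟩
  · exact (MvPolynomial.mem_restrictTotalDegree _ _ _).2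
      ((totalDegree_affinePoly_le _ _).trans hk)
  · simp only [pval, eval_affinePoly, map_sub]
    ring

lemma totalDegree_bind₁_le {σ τ R : Type*} [CommSemiring R] {f : σ → MvPolynomial τ R}
    (hf : ∀ i, (f i).totalDegree ≤ 1) (p : MvPolynomial σ R) :
    (MvPolynomial.bind₁ f p).totalDegree ≤ p.totalDegree := by
  rw [MvPolynomial.bind₁, MvPolynomial.aeval_def, MvPolynomial.eval₂_eq]
  refine MvPolynomial.totalDegree_finsetSum_le fun d hd => ?_
  refine (MvPolynomial.totalDegree_mul _ _).trans ?_
  have hprod : (∏ i ∈ d.support, f i ^ d i).totalDegree ≤ ∑ i ∈ d.support, d i := by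
    refine (MvPolynomial.totalDegree_finsetProd _ _).trans (Finset.sum_le_sum fun i _ => ?_)
    refine (MvPolynomial.totalDegree_pow _ _).trans ?_
    simpa using Nat.mul_le_mul_left (d i) (hf i)
  have hd' : ∑ i ∈ d.support, d i ≤ p.totalDegree := MvPolynomial.le_totalDegree hd
  simpa [MvPolynomial.algebraMap_eq] using hprod.trans hd'

/-- The polynomial `x ↦ p (w + H x)`. -/
def pullback (w : Plane) (H : Plane →L[ℝ] Plane) (p : Poly k) : Poly k :=
  ⟨MvPolynomial.bind₁ (fun i => affinePoly (w i) ((EuclideanSpace.proj i).comp H)) p.1,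
    (MvPolynomial.mem_restrictTotalDegree _ _ _).2 <|
      (totalDegree_bind₁_le (fun _ => totalDegree_affinePoly_le _ _) p.1).trans
        ((MvPolynomial.mem_restrictTotalDegree _ _ _).1 p.2)⟩

@[simp] lemma pval_pullback (w : Plane) (H : Plane →L[ℝ] Plane) (p : Poly k) (x : Plane) :
    pval (pullback w H p) x = pval p (w + H x) := by
  refine (MvPolynomial.eval₂Hom_bind₁ (RingHom.id ℝ) (fun i => x i) _ p.1).trans ?_
  exact congrArg (fun y : Fin 2 → ℝ => MvPolynomial.eval y p.1)
    (funext fun i => eval_affinePoly (w i) ((EuclideanSpace.proj i).comp H) x)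

end Poly

/-! ### The reference triangle -/

/-- The reference triangle as a subset of the plane. -/
def refTri : Set Plane := {ξ | 0 ≤ ξ 0 ∧ 0 ≤ ξ 1 ∧ ξ 0 + ξ 1 ≤ 1}

/-- The vertices, edge midpoints and barycenter of the reference triangle, in the order of
`TriMesh.node`. -/
def refNode : Fin 7 → Plane :=
  ![!₂[0, 0], !₂[1, 0], !₂[0, 1], !₂[1 / 2, 0], !₂[1 / 2, 1 / 2], !₂[0, 1 / 2], !₂[1 / 3, 1 / 3]]

lemma refNode_mem_refTri (q : Fin 7) : refNode q ∈ refTri := by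
  fin_cases q <;> simp [refNode, refTri] <;> norm_num

lemma norm_le_one_of_mem_refTri {ξ : Plane} (hξ : ξ ∈ refTri) : ‖ξ‖ ≤ 1 := by
  obtain ⟨h0, h1, h01⟩ := hξ
  rw [EuclideanSpace.norm_eq, Real.sqrt_le_one, Fin.sum_univ_two]
  simp only [Real.norm_eq_abs, sq_abs]
  nlinarith

lemma refTri_subset_closedBall : refTri ⊆ Metric.closedBall 0 2 := fun ξ hξ => by
  simpa using (norm_le_one_of_mem_refTri hξ).trans one_le_two

lemma convex_refTri : Convex ℝ refTri := by
  have hlin (i : Fin 2) : IsLinearMap ℝ fun ξ : Plane => ξ i :=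
    (EuclideanSpace.proj (𝕜 := ℝ) i).toLinearMap.isLinear
  have hsum : IsLinearMap ℝ fun ξ : Plane => ξ 0 + ξ 1 :=
    (EuclideanSpace.proj (𝕜 := ℝ) 0 + EuclideanSpace.proj 1 : Plane →L[ℝ] ℝ).toLinearMap.isLinear
  exact (convex_halfSpace_ge (hlin 0) 0).inter
    ((convex_halfSpace_ge (hlin 1) 0).inter (convex_halfSpace_le hsum 1))

lemma isCompact_refTri : IsCompact refTri := by
  have hcoord (i : Fin 2) : Continuous fun ξ : Plane => ξ i := by fun_prop
  have hclosed : IsClosed refTri :=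
    (isClosed_le continuous_const (hcoord 0)).inter
      ((isClosed_le continuous_const (hcoord 1)).inter
        (isClosed_le ((hcoord 0).add (hcoord 1)) continuous_const))
  exact (isCompact_closedBall 0 2).of_isClosed_subset hclosed refTri_subset_closedBall

lemma interior_refTri_nonempty : (interior refTri).Nonempty := by
  have hcoord (i : Fin 2) : Continuous fun ξ : Plane => ξ i := by fun_prop
  have hopen : IsOpen {ξ : Plane | 0 < ξ 0 ∧ 0 < ξ 1 ∧ ξ 0 + ξ 1 < 1} :=
    (isOpen_lt continuous_const (hcoord 0)).inter
      ((isOpen_lt continuous_const (hcoord 1)).inter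
        (isOpen_lt ((hcoord 0).add (hcoord 1)) continuous_const))
  have hsub : {ξ : Plane | 0 < ξ 0 ∧ 0 < ξ 1 ∧ ξ 0 + ξ 1 < 1} ⊆ refTri :=
    fun ξ h => ⟨h.1.le, h.2.1.le, h.2.2.le⟩
  exact ⟨!₂[1 / 3, 1 / 3], interior_maximal hsub hopen (by simp; norm_num)⟩

lemma refTri_subset_closure_interior : refTri ⊆ closure (interior refTri) := by
  rw [convex_refTri.closure_interior_eq_closure_of_nonempty_interior interior_refTri_nonempty]
  exact subset_closure

/-! ### Nodal interpolation -/

/-- The shape functions of the TRIA6 element as functions on the plane. -/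
def shapeFun (i : Fin 6) (ξ : Plane) : ℝ := shape (ξ 0) (ξ 1) i

lemma contDiff_shapeFun (i : Fin 6) : ContDiff ℝ ∞ (shapeFun i) := by
  unfold shapeFun shape
  fin_cases i <;> dsimp <;> fun_prop

lemma differentiable_shapeFun (i : Fin 6) : Differentiable ℝ (shapeFun i) :=
  (contDiff_shapeFun i).differentiable (by simp)

@[fun_prop]
lemma continuous_shapeFun (i : Fin 6) : Continuous (shapeFun i) := (contDiff_shapeFun i).continuous

@[fun_prop]
lemma continuous_fderiv_shapeFun (i : Fin 6) : Continuous (fderiv ℝ (shapeFun i)) :=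
  (contDiff_shapeFun i).continuous_fderiv (by simp)

lemma sum_shapeFun (ξ : Plane) : ∑ i, shapeFun i ξ = 1 := by
  simp [Fin.sum_univ_succ, shapeFun, shape]
  ring

lemma sum_shapeFun_smul_refNode (ξ : Plane) :
    ∑ i, shapeFun i ξ • refNode (Fin.castSucc i) = ξ := by
  ext k
  fin_cases k <;> simp [Fin.sum_univ_succ, shapeFun, shape, refNode] <;> ring

lemma shapeFun_refNode (i j : Fin 6) :
    shapeFun i (refNode j.castSucc) = if i = j then 1 else 0 := by
  fin_cases i <;> fin_cases j <;> simp [shapeFun, shape, refNode] <;> norm_num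

lemma monomial_eq_sum_shapeFun {m n : ℕ} (hmn : m + n ≤ 2) (ξ : Plane) :
    ξ 0 ^ m * ξ 1 ^ n
      = ∑ i : Fin 6, shapeFun i ξ * (refNode i.castSucc 0 ^ m * refNode i.castSucc 1 ^ n) := by
  have hm : m ≤ 2 := by omega
  have hn : n ≤ 2 := by omega
  interval_cases m <;> interval_cases n <;> first | omega | skip
  all_goals
    simp [Fin.sum_univ_succ, shapeFun, shape, refNode]
    try ring

lemma pval_eq_sum_shapeFun (p : Poly 2) (ξ : Plane) :
    pval p ξ = ∑ i, shapeFun i ξ * pval p (refNode i.castSucc) := by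
  have hp := (MvPolynomial.mem_restrictTotalDegree _ _ _).1 p.2
  simp only [pval, MvPolynomial.eval_eq', Fin.prod_univ_two, Finset.mul_sum]
  rw [Finset.sum_comm]
  refine Finset.sum_congr rfl fun d hd => ?_
  have hd2 : d 0 + d 1 ≤ 2 := by
    have := (MvPolynomial.le_totalDegree hd).trans hp
    rwa [Finsupp.sum_fintype _ _ (by simp), Fin.sum_univ_two] at this
  rw [monomial_eq_sum_shapeFun hd2, Finset.mul_sum]
  exact Finset.sum_congr rfl fun i _ => by ring

lemma exists_lebesgueConst : ∃ β : ℝ, 1 ≤ β ∧ ∀ ξ ∈ Metric.closedBall (0 : Plane) 2,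
    ∑ i, |shapeFun i ξ| ≤ β ∧ ∑ i, ‖fderiv ℝ (shapeFun i) ξ‖ ≤ β := by
  have hK : IsCompact (Metric.closedBall (0 : Plane) 2) := isCompact_closedBall 0 2
  obtain ⟨β₁, hβ₁⟩ := hK.bddAbove_image (f := fun ξ => ∑ i, |shapeFun i ξ|) (by fun_prop)
  obtain ⟨β₂, hβ₂⟩ := hK.bddAbove_image (f := fun ξ => ∑ i, ‖fderiv ℝ (shapeFun i) ξ‖)
    (by fun_prop)
  refine ⟨max 1 (max β₁ β₂), le_max_left _ _, fun ξ hξ => ⟨?_, ?_⟩⟩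
  · exact (hβ₁ (mem_image_of_mem _ hξ)).trans ((le_max_left _ _).trans (le_max_right _ _))
  · exact (hβ₂ (mem_image_of_mem _ hξ)).trans ((le_max_right _ _).trans (le_max_right _ _))

/-- A bound for the Lebesgue function of quadratic nodal interpolation and for that of its
derivative. The ball of radius `2` leaves room for displacing points of the reference triangle. -/
def lebesgueConst : ℝ := exists_lebesgueConst.choose

lemma one_le_lebesgueConst : 1 ≤ lebesgueConst := exists_lebesgueConst.choose_spec.1

lemma lebesgueConst_pos : 0 < lebesgueConst := zero_lt_one.trans_le one_le_lebesgueConst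

section

variable {ξ ζ : Plane}

lemma sum_abs_shapeFun_le (hξ : ξ ∈ Metric.closedBall 0 2) :
    ∑ i, |shapeFun i ξ| ≤ lebesgueConst := (exists_lebesgueConst.choose_spec.2 ξ hξ).1

lemma sum_norm_fderiv_shapeFun_le (hξ : ξ ∈ Metric.closedBall 0 2) :
    ∑ i, ‖fderiv ℝ (shapeFun i) ξ‖ ≤ lebesgueConst := (exists_lebesgueConst.choose_spec.2 ξ hξ).2

variable {F : Type*} [NormedAddCommGroup F] [NormedSpace ℝ F] {z : Fin 6 → F} {r : ℝ}

lemma norm_sum_shapeFun_smul_le (hξ : ξ ∈ Metric.closedBall 0 2) (hz : ∀ i, ‖z i‖ ≤ r) :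
    ‖∑ i, shapeFun i ξ • z i‖ ≤ lebesgueConst * r := by
  have hr : 0 ≤ r := (norm_nonneg _).trans (hz 0)
  calc ‖∑ i, shapeFun i ξ • z i‖ ≤ ∑ i, |shapeFun i ξ| * r := norm_sum_le_of_le _ fun i _ => by
        rw [norm_smul, Real.norm_eq_abs]
        exact mul_le_mul_of_nonneg_left (hz i) (abs_nonneg _)
    _ ≤ lebesgueConst * r := by
        rw [← Finset.sum_mul]
        exact mul_le_mul_of_nonneg_right (sum_abs_shapeFun_le hξ) hr

lemma hasFDerivAt_sum_shapeFun_smul (z : Fin 6 → F) (ξ : Plane) :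
    HasFDerivAt (fun ξ => ∑ i, shapeFun i ξ • z i)
      (∑ i, (fderiv ℝ (shapeFun i) ξ).smulRight (z i)) ξ :=
  HasFDerivAt.fun_sum fun i _ => (differentiable_shapeFun i ξ).hasFDerivAt.smul_const _

lemma norm_sum_fderiv_shapeFun_smulRight_le (hξ : ξ ∈ Metric.closedBall 0 2)
    (hz : ∀ i, ‖z i‖ ≤ r) :
    ‖∑ i, (fderiv ℝ (shapeFun i) ξ).smulRight (z i)‖ ≤ lebesgueConst * r := by
  have hr : 0 ≤ r := (norm_nonneg _).trans (hz 0)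
  calc ‖∑ i, (fderiv ℝ (shapeFun i) ξ).smulRight (z i)‖
      ≤ ∑ i, ‖fderiv ℝ (shapeFun i) ξ‖ * r := norm_sum_le_of_le _ fun i _ => by
        rw [ContinuousLinearMap.norm_smulRight_apply]
        exact mul_le_mul_of_nonneg_left (hz i) (norm_nonneg _)
    _ ≤ lebesgueConst * r := by
        rw [← Finset.sum_mul]
        exact mul_le_mul_of_nonneg_right (sum_norm_fderiv_shapeFun_le hξ) hr

lemma norm_sum_shapeFun_smul_sub_le (hξ : ξ ∈ Metric.closedBall 0 2)
    (hζ : ζ ∈ Metric.closedBall 0 2) (hz : ∀ i, ‖z i‖ ≤ r) :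
    ‖∑ i, shapeFun i ζ • z i - ∑ i, shapeFun i ξ • z i‖ ≤ lebesgueConst * r * ‖ζ - ξ‖ :=
  (convex_closedBall (0 : Plane) 2).norm_image_sub_le_of_norm_hasFDerivWithin_le
    (fun x _ => (hasFDerivAt_sum_shapeFun_smul z x).hasFDerivWithinAt)
    (fun _ hx => norm_sum_fderiv_shapeFun_smulRight_le hx hz) hξ hζ

end

/-- The maximum of the values of a quadratic polynomial at the six nodes that determine it. -/
def nodalNorm (p : Poly 2) : ℝ := ‖fun i : Fin 6 => pval p (refNode i.castSucc)‖

lemma nodalNorm_nonneg (p : Poly 2) : 0 ≤ nodalNorm p := norm_nonneg _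

lemma abs_pval_refNode_le (p : Poly 2) (i : Fin 6) :
    |pval p (refNode i.castSucc)| ≤ nodalNorm p :=
  norm_le_pi_norm (fun i : Fin 6 => pval p (refNode i.castSucc)) i

lemma abs_pval_le (p : Poly 2) {ξ : Plane} (hξ : ξ ∈ Metric.closedBall 0 2) :
    |pval p ξ| ≤ lebesgueConst * nodalNorm p := by
  rw [pval_eq_sum_shapeFun p ξ]
  exact norm_sum_shapeFun_smul_le (z := fun i => pval p (refNode i.castSucc)) hξ
    (abs_pval_refNode_le p)

lemma abs_pval_sub_le (p : Poly 2) {ξ ζ : Plane} (hξ : ξ ∈ Metric.closedBall 0 2)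
    (hζ : ζ ∈ Metric.closedBall 0 2) :
    |pval p ζ - pval p ξ| ≤ lebesgueConst * nodalNorm p * ‖ζ - ξ‖ := by
  rw [pval_eq_sum_shapeFun p ξ, pval_eq_sum_shapeFun p ζ]
  exact norm_sum_shapeFun_smul_sub_le (z := fun i => pval p (refNode i.castSucc)) hξ hζ
    (abs_pval_refNode_le p)

lemma eq_zero_of_nodalNorm_eq_zero {p : Poly 2} (hp : nodalNorm p = 0) : p = 0 := by
  have hnode := congrFun (norm_eq_zero.1 hp)
  simp only [Pi.zero_apply] at hnode
  exact pval_injective (funext fun ξ => by simp [pval_eq_sum_shapeFun p ξ, hnode])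

lemma eqOn_zero_of_setIntegral_mul_self_eq_zero {X : Type*} [TopologicalSpace X] [T2Space X]
    [MeasurableSpace X] [OpensMeasurableSpace X] {μ : Measure X} [μ.IsOpenPosMeasure]
    [IsFiniteMeasureOnCompacts μ] {K : Set X} (hK : IsCompact K) (hKi : K ⊆ closure (interior K))
    {f : X → ℝ} (hf : Continuous f) (h : ∫ x in K, f x * f x ∂μ = 0) : EqOn f 0 K := by
  have hint : IntegrableOn (fun x => f x * f x) K μ :=
    (hf.mul hf).continuousOn.integrableOn_compact hK
  have hae : (fun x => f x * f x) =ᵐ[μ.restrict K] 0 :=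
    (setIntegral_eq_zero_iff_of_nonneg_ae (.of_forall fun x => mul_self_nonneg _) hint).1 h
  have hfae : f =ᵐ[μ.restrict (interior K)] 0 :=
    (ae_restrict_of_ae_restrict_of_subset interior_subset hae).mono fun x hx =>
      mul_self_eq_zero.1 hx
  have hEq : EqOn f 0 (interior K) :=
    Measure.eqOn_open_of_ae_eq hfae isOpen_interior hf.continuousOn continuousOn_const
  exact (hEq.closure hf continuous_const).mono hKi

lemma exists_pos_mul_norm_sq_le {V : Type*} [NormedAddCommGroup V] [NormedSpace ℝ V]
    [FiniteDimensional ℝ V] {Q : V → ℝ} (hQ : Continuous Q)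
    (hsmul : ∀ (r : ℝ) v, Q (r • v) = r ^ 2 * Q v) (hpos : ∀ v, v ≠ 0 → 0 < Q v) :
    ∃ c : ℝ, 0 < c ∧ ∀ v, c * ‖v‖ ^ 2 ≤ Q v := by
  have hQ0 : Q 0 = 0 := by simpa using hsmul 0 0
  cases subsingleton_or_nontrivial V
  · exact ⟨1, one_pos, fun v => by simp [Subsingleton.elim v 0, hQ0]⟩
  obtain ⟨v₀, hv₀, hmin⟩ := (isCompact_sphere (0 : V) 1).exists_isMinOn
    (NormedSpace.sphere_nonempty.2 zero_le_one) hQ.continuousOn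
  refine ⟨Q v₀, hpos v₀ (ne_zero_of_mem_unit_sphere ⟨v₀, hv₀⟩), fun v => ?_⟩
  rcases eq_or_ne v 0 with rfl | hv
  · simp [hQ0]
  have hunit : Q v₀ ≤ Q (‖v‖⁻¹ • v) := hmin (by simp [norm_smul, norm_ne_zero_iff.2 hv])
  calc Q v₀ * ‖v‖ ^ 2 ≤ Q (‖v‖⁻¹ • v) * ‖v‖ ^ 2 := by gcongr
    _ = Q v := by
      rw [hsmul]
      field_simp [norm_ne_zero_iff.2 hv]

lemma exists_coercivity : ∃ c : ℝ, 0 < c ∧ ∀ p : Poly 2,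
    c * nodalNorm p ^ 2 ≤ ∫ ξ in refTri, pval p ξ * pval p ξ := by
  let interp (z : Fin 6 → ℝ) (ξ : Plane) : ℝ := ∑ i, shapeFun i ξ * z i
  let Q (z : Fin 6 → ℝ) : ℝ := ∫ ξ in refTri, interp z ξ * interp z ξ
  have hinterp (z : Fin 6 → ℝ) (j : Fin 6) : interp z (refNode j.castSucc) = z j := by
    simp [interp, shapeFun_refNode]
  have hcont : Continuous Q := continuous_parametric_integral_of_continuous
    (f := fun z ξ => interp z ξ * interp z ξ) (by fun_prop) isCompact_refTri
  have hsmul (r : ℝ) (z : Fin 6 → ℝ) : Q (r • z) = r ^ 2 * Q z := by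
    have (ξ : Plane) : interp (r • z) ξ = r * interp z ξ := by
      simp only [interp, Finset.mul_sum, Pi.smul_apply, smul_eq_mul]
      exact Finset.sum_congr rfl fun i _ => by ring
    simp only [Q, this, ← integral_const_mul]
    exact integral_congr_ae (.of_forall fun ξ => by ring)
  have hpos (z : Fin 6 → ℝ) (hz : z ≠ 0) : 0 < Q z := by
    refine (integral_nonneg fun ξ => mul_self_nonneg _).lt_of_ne' fun h0 => hz ?_
    have hzero := eqOn_zero_of_setIntegral_mul_self_eq_zero isCompact_refTri
      refTri_subset_closure_interior (by fun_prop) h0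
    exact funext fun j => (hinterp z j).symm.trans (hzero (refNode_mem_refTri _))
  obtain ⟨c, hc, hcQ⟩ := exists_pos_mul_norm_sq_le hcont hsmul hpos
  refine ⟨c, hc, fun p => (hcQ _).trans_eq ?_⟩
  simp only [Q, interp, ← pval_eq_sum_shapeFun]

/-! ### Perturbations of the nodes -/

/-- The map of the reference triangle that moves the first six nodes by `ρ` and interpolates
quadratically in between. -/
def perturb (ρ : Fin 7 → Plane) (ξ : Plane) : Plane := ξ + ∑ i, shapeFun i ξ • ρ i.castSucc

/-- The derivative of `perturb ρ` minus the identity. -/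
def perturbDeriv (ρ : Fin 7 → Plane) (ξ : Plane) : Plane →L[ℝ] Plane :=
  ∑ i, (fderiv ℝ (shapeFun i) ξ).smulRight (ρ i.castSucc)

lemma hasFDerivAt_perturb (ρ : Fin 7 → Plane) (ξ : Plane) :
    HasFDerivAt (perturb ρ) (ContinuousLinearMap.id ℝ Plane + perturbDeriv ρ ξ) ξ :=
  (hasFDerivAt_id ξ).add (hasFDerivAt_sum_shapeFun_smul _ ξ)

@[fun_prop]
lemma continuous_perturb (ρ : Fin 7 → Plane) : Continuous (perturb ρ) := by
  unfold perturb
  fun_prop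

@[fun_prop]
lemma continuous_perturbDeriv (ρ : Fin 7 → Plane) : Continuous (perturbDeriv ρ) := by
  have (i : Fin 6) : Continuous fun ξ => (fderiv ℝ (shapeFun i) ξ).smulRight (ρ i.castSucc) :=
    (ContinuousLinearMap.smulRightL ℝ Plane Plane).flip (ρ i.castSucc) |>.continuous.comp
      (continuous_fderiv_shapeFun i)
  exact continuous_finsetSum _ fun i _ => this i

section

variable {ρ : Fin 7 → Plane} {ε : ℝ} (hρ : ∀ q, ‖ρ q‖ ≤ ε)
include hρ

lemma norm_perturbDeriv_le {ξ : Plane} (hξ : ξ ∈ Metric.closedBall 0 2) :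
    ‖perturbDeriv ρ ξ‖ ≤ lebesgueConst * ε :=
  norm_sum_fderiv_shapeFun_smulRight_le hξ fun i => hρ i.castSucc

lemma norm_perturb_sub_le {ξ : Plane} (hξ : ξ ∈ Metric.closedBall 0 2) :
    ‖perturb ρ ξ - ξ‖ ≤ lebesgueConst * ε := by
  rw [perturb, add_sub_cancel_left]
  exact norm_sum_shapeFun_smul_le hξ fun i => hρ i.castSucc

lemma injOn_perturb (hε : lebesgueConst * ε < 1) :
    InjOn (perturb ρ) (Metric.closedBall 0 2) := by
  intro ξ hξ ζ hζ h
  have hlip : ‖ζ - ξ‖ ≤ lebesgueConst * ε * ‖ζ - ξ‖ := by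
    calc ‖ζ - ξ‖ = ‖(perturb ρ ζ - ζ) - (perturb ρ ξ - ξ)‖ := by
          rw [h, sub_sub_sub_cancel_left, norm_sub_rev]
      _ ≤ lebesgueConst * ε * ‖ζ - ξ‖ := by
          simp only [perturb, add_sub_cancel_left]
          exact norm_sum_shapeFun_smul_sub_le hξ hζ fun i => hρ i.castSucc
  have : ‖ζ - ξ‖ = 0 := by nlinarith [norm_nonneg (ζ - ξ)]
  exact (sub_eq_zero.1 (norm_eq_zero.1 this)).symm

end

lemma abs_le_sqrt_card_mul {ι : Type*} [Fintype ι] {x y : ι → ℝ} {r : ℝ}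
    (hxy : ∑ i, x i ^ 2 ≤ ∑ i, y i ^ 2) (hy : ∀ i, |y i| ≤ r) (i : ι) :
    |x i| ≤ √(Fintype.card ι) * r := by
  have hr : 0 ≤ r := (abs_nonneg _).trans (hy i)
  refine abs_le_of_sq_le_sq ?_ (by positivity)
  calc x i ^ 2 ≤ ∑ i, x i ^ 2 :=
        Finset.single_le_sum (f := fun i => x i ^ 2) (fun i _ => sq_nonneg _) (Finset.mem_univ i)
    _ ≤ ∑ i, y i ^ 2 := hxy
    _ ≤ ∑ _i : ι, r ^ 2 := Finset.sum_le_sum fun i _ => sq_le_sq.2 ((hy i).trans (le_abs_self r))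
    _ = (√(Fintype.card ι) * r) ^ 2 := by simp [mul_pow]

lemma nodalNorm_fit_sub_le {ρ : Fin 7 → Plane} {ε : ℝ} (hρ : ∀ q, ‖ρ q‖ ≤ ε)
    (hε : 2 * (lebesgueConst * ε) ≤ 1) {f F : Poly 2}
    (h : ∑ q, (pval f (refNode q + ρ q) - pval F (refNode q)) ^ 2
      ≤ ∑ q, (pval F (refNode q + ρ q) - pval F (refNode q)) ^ 2) :
    nodalNorm (f - F) ≤ 2 * (√7 + 1) * lebesgueConst * ε * nodalNorm F := by
  have hβ := one_le_lebesgueConst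
  have hε0 : 0 ≤ ε := (norm_nonneg _).trans (hρ 0)
  have hnode (q : Fin 7) : ‖refNode q‖ ≤ 1 := norm_le_one_of_mem_refTri (refNode_mem_refTri q)
  have hmove (p : Poly 2) (q : Fin 7) :
      |pval p (refNode q + ρ q) - pval p (refNode q)| ≤ lebesgueConst * ε * nodalNorm p := by
    have hmem : refNode q + ρ q ∈ Metric.closedBall 0 2 := by
      rw [mem_closedBall_zero_iff]
      nlinarith [norm_add_le (refNode q) (ρ q), hnode q, hρ q]
    calc |pval p (refNode q + ρ q) - pval p (refNode q)|
        ≤ lebesgueConst * nodalNorm p * ‖refNode q + ρ q - refNode q‖ :=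
          abs_pval_sub_le p (refTri_subset_closedBall (refNode_mem_refTri q)) hmem
      _ ≤ lebesgueConst * nodalNorm p * ε := by
          rw [add_sub_cancel_left]
          exact mul_le_mul_of_nonneg_left (hρ q)
            (mul_nonneg lebesgueConst_pos.le (nodalNorm_nonneg p))
      _ = lebesgueConst * ε * nodalNorm p := by ring
  have hfit (q : Fin 7) : |pval f (refNode q + ρ q) - pval F (refNode q)|
      ≤ √7 * (lebesgueConst * ε * nodalNorm F) := by
    simpa using abs_le_sqrt_card_mul h (hmove F) q
  have habsorb : nodalNorm (f - F) ≤ lebesgueConst * ε * nodalNorm (f - F)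
      + √7 * (lebesgueConst * ε * nodalNorm F) + lebesgueConst * ε * nodalNorm F := by
    refine (pi_norm_le_iff_of_nonempty _).2 fun i => ?_
    have hd := hmove (f - F) i.castSucc
    simp only [pval_sub, Real.norm_eq_abs] at hd ⊢
    have hf := hfit i.castSucc
    have hF := hmove F i.castSucc
    rw [abs_le] at hd hf hF ⊢
    constructor <;> linarith
  nlinarith [nodalNorm_nonneg (f - F)]

/-! ### Uniform Taylor bounds on compact sets -/

section Taylor

open Filter

variable {E F : Type*} [NormedAddCommGroup E] [NormedSpace ℝ E] [NormedAddCommGroup F]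
  [NormedSpace ℝ F] {f : E → F} {S U : Set E} {C : ℝ}

/-- On `S` the function `f` and its derivative are bounded by `C` and Lipschitz with constant `C`,
and the first-order Taylor expansions of `f` between points of `S` have quadratic remainders with
constant `C`. On a nonconvex `S` the last three bounds are independent conditions. -/
structure TaylorBoundedOn (f : E → F) (S : Set E) (C : ℝ) : Prop where
  differentiableAt : ∀ p ∈ S, DifferentiableAt ℝ f p
  norm_le : ∀ p ∈ S, ‖f p‖ ≤ C
  norm_fderiv_le : ∀ p ∈ S, ‖fderiv ℝ f p‖ ≤ C
  norm_sub_le : ∀ p ∈ S, ∀ q ∈ S, ‖f q - f p‖ ≤ C * ‖q - p‖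
  norm_fderiv_sub_le : ∀ p ∈ S, ∀ q ∈ S, ‖fderiv ℝ f q - fderiv ℝ f p‖ ≤ C * ‖q - p‖
  norm_remainder_le : ∀ p ∈ S, ∀ q ∈ S,
    ‖f q - f p - fderiv ℝ f p (q - p)‖ ≤ C * ‖q - p‖ ^ 2

lemma exists_norm_sub_le_of_contDiffOn (hS : IsCompact S) (hU : IsOpen U) (hSU : S ⊆ U)
    (hf : ContDiffOn ℝ 1 f U) :
    ∃ C : ℝ, 0 ≤ C ∧ ∀ p ∈ S, ∀ q ∈ S, ‖f q - f p‖ ≤ C * ‖q - p‖ := by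
  have hloc : LocallyLipschitzOn S f := fun x hx => by
    obtain ⟨K, t, ht, hK⟩ := (hf.contDiffAt (hU.mem_nhds (hSU hx))).exists_lipschitzOnWith
    exact ⟨K, t, mem_nhdsWithin_of_mem_nhds ht, hK⟩
  obtain ⟨K, hK⟩ := hloc.exists_lipschitzOnWith_of_compact hS
  exact ⟨K, K.2, fun p hp q hq => hK.norm_sub_le hq hp⟩

lemma norm_remainder_le_of_closedBall {p q : E}
    (hdiff : ∀ x ∈ Metric.closedBall p ‖q - p‖, DifferentiableAt ℝ f x)
    (hlip : ∀ x ∈ Metric.closedBall p ‖q - p‖, ‖fderiv ℝ f x - fderiv ℝ f p‖ ≤ C * ‖x - p‖)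
    (hC : 0 ≤ C) : ‖f q - f p - fderiv ℝ f p (q - p)‖ ≤ C * ‖q - p‖ ^ 2 := by
  rw [pow_two, ← mul_assoc]
  exact (convex_closedBall p ‖q - p‖).norm_image_sub_le_of_norm_hasFDerivWithin_le'
    (fun x hx => (hdiff x hx).hasFDerivAt.hasFDerivWithinAt)
    (fun x hx => (hlip x hx).trans (mul_le_mul_of_nonneg_left (mem_closedBall_iff_norm.1 hx) hC))
    (Metric.mem_closedBall_self (norm_nonneg _)) (mem_closedBall_iff_norm.2 le_rfl)

lemma exists_norm_remainder_le_of_contDiffOn [ProperSpace E] (hS : IsCompact S) (hU : IsOpen U)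
    (hSU : S ⊆ U) (hf : ContDiffOn ℝ 2 f U) :
    ∃ C : ℝ, ∀ p ∈ S, ∀ q ∈ S, ‖f q - f p - fderiv ℝ f p (q - p)‖ ≤ C * ‖q - p‖ ^ 2 := by
  obtain ⟨δ, hδ, hδU⟩ := hS.exists_cthickening_subset_open hU hSU
  have hf' : ContDiffOn ℝ 1 (fderiv ℝ f) U := hf.fderiv_of_isOpen hU (by norm_num)
  obtain ⟨C₁, hC₁, h₁⟩ := exists_norm_sub_le_of_contDiffOn (hS.cthickening (r := δ)) hU hδU hf'
  obtain ⟨C₂, -, h₂⟩ := exists_norm_sub_le_of_contDiffOn hS hU hSU (hf.of_le (by norm_num))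
  obtain ⟨C₃, h₃⟩ := hS.exists_bound_of_continuousOn (hf'.continuousOn.mono hSU)
  refine ⟨max C₁ ((C₂ + C₃) / δ), fun p hp q hq => ?_⟩
  rcases le_or_gt ‖q - p‖ δ with hnear | hfar
  · have hball : Metric.closedBall p ‖q - p‖ ⊆ Metric.cthickening δ S :=
      (Metric.closedBall_subset_closedBall hnear).trans (Metric.closedBall_subset_cthickening hp δ)
    refine (norm_remainder_le_of_closedBall (C := C₁)
      (fun x hx => (hf.contDiffAt (hU.mem_nhds (hδU (hball hx)))).differentiableAt (by norm_num))
      (fun x hx => h₁ p (Metric.self_subset_cthickening S hp) x (hball hx)) hC₁).trans ?_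
    gcongr
    exact le_max_left _ _
  · calc ‖f q - f p - fderiv ℝ f p (q - p)‖ ≤ ‖f q - f p‖ + ‖fderiv ℝ f p (q - p)‖ :=
          norm_sub_le _ _
      _ ≤ C₂ * ‖q - p‖ + C₃ * ‖q - p‖ :=
          add_le_add (h₂ p hp q hq) (ContinuousLinearMap.le_of_opNorm_le _ (h₃ p hp) _)
      _ = (C₂ + C₃) / δ * (δ * ‖q - p‖) := by field_simp
      _ ≤ max C₁ ((C₂ + C₃) / δ) * ‖q - p‖ ^ 2 := by
          rw [pow_two]
          gcongr
          exact le_max_right _ _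

lemma eventually_taylorBoundedOn [ProperSpace E] (hS : IsCompact S) (hU : IsOpen U) (hSU : S ⊆ U)
    (hf : ContDiffOn ℝ 2 f U) : ∀ᶠ C in atTop, TaylorBoundedOn f S C := by
  have hf' : ContDiffOn ℝ 1 (fderiv ℝ f) U := hf.fderiv_of_isOpen hU (by norm_num)
  obtain ⟨C₁, h₁⟩ := hS.exists_bound_of_continuousOn (hf.continuousOn.mono hSU)
  obtain ⟨C₂, h₂⟩ := hS.exists_bound_of_continuousOn (hf'.continuousOn.mono hSU)
  obtain ⟨C₃, -, h₃⟩ := exists_norm_sub_le_of_contDiffOn hS hU hSU (hf.of_le (by norm_num))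
  obtain ⟨C₄, -, h₄⟩ := exists_norm_sub_le_of_contDiffOn hS hU hSU hf'
  obtain ⟨C₅, h₅⟩ := exists_norm_remainder_le_of_contDiffOn hS hU hSU hf
  filter_upwards [eventually_ge_atTop C₁, eventually_ge_atTop C₂, eventually_ge_atTop C₃,
    eventually_ge_atTop C₄, eventually_ge_atTop C₅] with C hC₁ hC₂ hC₃ hC₄ hC₅
  exact
    { differentiableAt := fun p hp =>
        (hf.contDiffAt (hU.mem_nhds (hSU hp))).differentiableAt (by norm_num)
      norm_le := fun p hp => (h₁ p hp).trans hC₁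
      norm_fderiv_le := fun p hp => (h₂ p hp).trans hC₂
      norm_sub_le := fun p hp q hq => (h₃ p hp q hq).trans (by gcongr)
      norm_fderiv_sub_le := fun p hp q hq => (h₄ p hp q hq).trans (by gcongr)
      norm_remainder_le := fun p hp q hq => (h₅ p hp q hq).trans (by gcongr) }

end Taylor

/-! ### Feet of characteristics -/

section Characteristics

lemma norm_prodMk_le_add {E F : Type*} [SeminormedAddGroup E] [SeminormedAddGroup F] (x : E)
    (y : F) : ‖(x, y)‖ ≤ ‖x‖ + ‖y‖ :=
  max_le (le_add_of_nonneg_right (norm_nonneg y)) (le_add_of_nonneg_left (norm_nonneg x))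

variable {E : Type*} [NormedAddCommGroup E] [NormedSpace ℝ E]

/-- The acceleration `∂ₜA + (A · ∇)A` along the characteristics of the velocity field `A`. -/
def accel (A : E × ℝ → E) (p : E × ℝ) : E := fderiv ℝ A p (A p, 1)

/-- The spatial derivative of the velocity field `A`. -/
def spaceDeriv (A : E × ℝ → E) (p : E × ℝ) : E →L[ℝ] E :=
  (fderiv ℝ A p).comp (ContinuousLinearMap.inl ℝ E ℝ)

/-- The linear part of the affine approximation at `p` of the backward flow over the time `Δ`. -/
def stepLin (A : E × ℝ → E) (p : E × ℝ) (Δ : ℝ) : E →L[ℝ] E :=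
  ContinuousLinearMap.id ℝ E - Δ • spaceDeriv A p

/-- The image of the base point under the affine approximation at `p` of the backward flow over the
time `Δ`. -/
def stepBase (A : E × ℝ → E) (p : E × ℝ) (Δ : ℝ) : E :=
  p.1 - Δ • A p + (Δ ^ 2 / 2) • accel A p

lemma norm_spaceDeriv_le (A : E × ℝ → E) (p : E × ℝ) : ‖spaceDeriv A p‖ ≤ ‖fderiv ℝ A p‖ :=
  ContinuousLinearMap.opNorm_le_bound _ (norm_nonneg _) fun x => by
    simpa [spaceDeriv] using (fderiv ℝ A p).le_opNorm (x, 0)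

section

variable {A : E × ℝ → E} {S : Set (E × ℝ)} {C : ℝ} {p q : E × ℝ}

lemma TaylorBoundedOn.norm_prodMk_one_le (hA : TaylorBoundedOn A S C) (hC : 1 ≤ C) (hp : p ∈ S) :
    ‖(A p, (1 : ℝ))‖ ≤ C :=
  max_le (hA.norm_le p hp) (by simpa using hC)

lemma TaylorBoundedOn.norm_accel_le (hA : TaylorBoundedOn A S C) (hC : 1 ≤ C) (hp : p ∈ S) :
    ‖accel A p‖ ≤ C ^ 2 := by
  rw [pow_two]
  exact ((fderiv ℝ A p).le_opNorm _).trans <| mul_le_mul (hA.norm_fderiv_le p hp)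
    (hA.norm_prodMk_one_le hC hp) (norm_nonneg _) (zero_le_one.trans hC)

lemma TaylorBoundedOn.norm_accel_sub_le (hA : TaylorBoundedOn A S C) (hC : 1 ≤ C) (hp : p ∈ S)
    (hq : q ∈ S) : ‖accel A q - accel A p‖ ≤ 2 * C ^ 2 * ‖q - p‖ := by
  have hC0 : 0 ≤ C := zero_le_one.trans hC
  have hsplit : accel A q - accel A p
      = fderiv ℝ A q (A q - A p, 0) + (fderiv ℝ A q - fderiv ℝ A p) (A p, 1) := by
    have : ((A q - A p, 0) : E × ℝ) = (A q, 1) - (A p, 1) := by simp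
    rw [this, map_sub]
    simp [accel]
  have hvel : ‖fderiv ℝ A q (A q - A p, 0)‖ ≤ C * (C * ‖q - p‖) :=
    ((fderiv ℝ A q).le_opNorm _).trans <| mul_le_mul (hA.norm_fderiv_le q hq)
      (by simpa using hA.norm_sub_le p hp q hq) (norm_nonneg _) hC0
  have hjac : ‖(fderiv ℝ A q - fderiv ℝ A p) (A p, 1)‖ ≤ C * ‖q - p‖ * C :=
    (ContinuousLinearMap.le_opNorm _ _).trans <| mul_le_mul (hA.norm_fderiv_sub_le p hp q hq)
      (hA.norm_prodMk_one_le hC hp) (norm_nonneg _) (by positivity)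
  rw [hsplit]
  linarith [norm_add_le (fderiv ℝ A q (A q - A p, 0)) ((fderiv ℝ A q - fderiv ℝ A p) (A p, 1))]

end

lemma norm_taylor_two_le {γ v w : ℝ → E} {s t η : ℝ} {B : E} (hst : s ≤ t)
    (hγ : ∀ τ ∈ Icc s t, HasDerivWithinAt γ (v τ) (Icc s t) τ)
    (hv : ∀ τ ∈ Icc s t, HasDerivWithinAt v (w τ) (Icc s t) τ)
    (hw : ∀ τ ∈ Icc s t, ‖w τ - B‖ ≤ η) :
    ‖γ s - (γ t - (t - s) • v t + ((t - s) ^ 2 / 2) • B)‖ ≤ η * (t - s) ^ 2 := by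
  have htI : t ∈ Icc s t := right_mem_Icc.2 hst
  have hη : 0 ≤ η := (norm_nonneg _).trans (hw t htI)
  have hdist {τ : ℝ} (hτ : τ ∈ Icc s t) : ‖τ - t‖ ≤ t - s := by
    rw [Real.norm_eq_abs, abs_le]
    constructor <;> linarith [hτ.1, hτ.2]
  have hfirst : ∀ τ ∈ Icc s t, ‖v τ - v t - (τ - t) • B‖ ≤ η * (t - s) := fun τ hτ => by
    have hderiv (y) (hy : y ∈ Icc s t) :
        HasDerivWithinAt (fun τ => v τ - τ • B) (w y - B) (Icc s t) y :=
      (hv y hy).sub (by simpa using (hasDerivWithinAt_id y _).smul_const B)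
    calc ‖v τ - v t - (τ - t) • B‖ = ‖v τ - τ • B - (v t - t • B)‖ := by
          congr 1
          module
      _ ≤ η * ‖τ - t‖ :=
          (convex_Icc s t).norm_image_sub_le_of_norm_hasDerivWithin_le hderiv hw htI hτ
      _ ≤ η * (t - s) := mul_le_mul_of_nonneg_left (hdist hτ) hη
  have hderiv (y) (hy : y ∈ Icc s t) :
      HasDerivWithinAt (fun τ => γ τ - τ • v t - ((τ - t) ^ 2 / 2) • B)
        (v y - v t - (y - t) • B) (Icc s t) y := by
    have hquad : HasDerivAt (fun τ : ℝ => (τ - t) ^ 2 / 2) (y - t) y := by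
      simpa using (((hasDerivAt_id y).sub_const t).pow 2).div_const 2
    exact ((hγ y hy).sub (by simpa using (hasDerivWithinAt_id y _).smul_const (v t))).sub
      (hquad.hasDerivWithinAt.smul_const B)
  have hsI : s ∈ Icc s t := left_mem_Icc.2 hst
  calc ‖γ s - (γ t - (t - s) • v t + ((t - s) ^ 2 / 2) • B)‖
      = ‖γ s - s • v t - ((s - t) ^ 2 / 2) • B - (γ t - t • v t - ((t - t) ^ 2 / 2) • B)‖ := by
        congr 1
        module
    _ ≤ η * (t - s) * ‖s - t‖ :=
        (convex_Icc s t).norm_image_sub_le_of_norm_hasDerivWithin_le hderiv hfirst htI hsI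
    _ ≤ η * (t - s) * (t - s) :=
        mul_le_mul_of_nonneg_left (hdist hsI) (mul_nonneg hη (sub_nonneg.2 hst))
    _ = η * (t - s) ^ 2 := by ring

variable {A : E × ℝ → E} {S : Set (E × ℝ)} {C : ℝ} {s t h : ℝ} {γ : ℝ → E} {x₀ : E}

lemma norm_characteristic_sub_taylor_le (hA : TaylorBoundedOn A S C) (hC : 1 ≤ C) (hst : s ≤ t)
    (hγS : ∀ τ ∈ Icc s t, (γ τ, τ) ∈ S)
    (hγ : ∀ τ ∈ Icc s t, HasDerivWithinAt γ (A (γ τ, τ)) (Icc s t) τ)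
    (hx₀ : (x₀, t) ∈ S) (hh : ‖γ t - x₀‖ ≤ h) :
    ‖γ s - (γ t - (t - s) • A (γ t, t) + ((t - s) ^ 2 / 2) • accel A (x₀, t))‖
      ≤ 2 * C ^ 2 * ((C + 1) * (t - s) + h) * (t - s) ^ 2 := by
  have htI : t ∈ Icc s t := right_mem_Icc.2 hst
  refine norm_taylor_two_le hst hγ (v := fun τ => A (γ τ, τ)) (w := fun τ => accel A (γ τ, τ))
    (fun τ hτ => HasFDerivAt.comp_hasDerivWithinAt τ (f := fun τ => (γ τ, τ))
      (hA.differentiableAt _ (hγS τ hτ)).hasFDerivAt ((hγ τ hτ).prodMk (hasDerivWithinAt_id τ _)))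
    fun τ hτ => (hA.norm_accel_sub_le hC hx₀ (hγS τ hτ)).trans ?_
  have htime : ‖τ - t‖ ≤ t - s := by
    rw [Real.norm_eq_abs, abs_le]
    constructor <;> linarith [hτ.1, hτ.2]
  have hspace : ‖γ τ - γ t‖ ≤ C * (t - s) :=
    ((convex_Icc s t).norm_image_sub_le_of_norm_hasDerivWithin_le hγ
      (fun y hy => hA.norm_le _ (hγS y hy)) htI hτ).trans
      (mul_le_mul_of_nonneg_left htime (zero_le_one.trans hC))
  have hprod : ‖(γ τ, τ) - (x₀, t)‖ ≤ (C + 1) * (t - s) + h := by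
    rw [Prod.mk_sub_mk]
    linarith [norm_prodMk_le_add (γ τ - x₀) (τ - t),
      norm_sub_le_norm_sub_add_norm_sub (γ τ) (γ t) x₀]
  gcongr

lemma norm_foot_sub_le (hA : TaylorBoundedOn A S C) (hC : 1 ≤ C) (hst : s ≤ t)
    (hγS : ∀ τ ∈ Icc s t, (γ τ, τ) ∈ S)
    (hγ : ∀ τ ∈ Icc s t, HasDerivWithinAt γ (A (γ τ, τ)) (Icc s t) τ)
    (hx₀ : (x₀, t) ∈ S) (hh : ‖γ t - x₀‖ ≤ h) :
    ‖γ s - (stepBase A (x₀, t) (t - s) + stepLin A (x₀, t) (t - s) (γ t - x₀))‖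
      ≤ 2 * C ^ 2 * ((C + 1) * (t - s) + h) * (t - s) ^ 2 + (t - s) * (C * h ^ 2) := by
  have hΔ : 0 ≤ t - s := sub_nonneg.2 hst
  have hC0 : 0 ≤ C := zero_le_one.trans hC
  have hvel : ‖A (γ t, t) - A (x₀, t) - spaceDeriv A (x₀, t) (γ t - x₀)‖ ≤ C * h ^ 2 := by
    have := hA.norm_remainder_le _ hx₀ _ (hγS t (right_mem_Icc.2 hst))
    simp only [Prod.mk_sub_mk, sub_self] at this
    refine this.trans (mul_le_mul_of_nonneg_left (pow_le_pow_left₀ (norm_nonneg _) ?_ 2) hC0)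
    simpa using hh
  have hsplit : γ s - (stepBase A (x₀, t) (t - s) + stepLin A (x₀, t) (t - s) (γ t - x₀))
      = (γ s - (γ t - (t - s) • A (γ t, t) + ((t - s) ^ 2 / 2) • accel A (x₀, t)))
        - (t - s) • (A (γ t, t) - A (x₀, t) - spaceDeriv A (x₀, t) (γ t - x₀)) := by
    simp only [stepBase, stepLin, sub_apply, smul_apply, ContinuousLinearMap.id_apply]
    module
  rw [hsplit]
  refine (norm_sub_le _ _).trans (add_le_add
    (norm_characteristic_sub_taylor_le hA hC hst hγS hγ hx₀ hh) ?_)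
  rw [norm_smul, Real.norm_of_nonneg hΔ]
  exact mul_le_mul_of_nonneg_left hvel hΔ

end Characteristics

/-! ### The transport equation -/

section Transport

/-- The velocity field `(a, b)`. -/
def velocity (a b : Plane × ℝ → ℝ) (p : Plane × ℝ) : Plane := !₂[a p, b p]

lemma trace_plane (M : Plane →L[ℝ] Plane) :
    LinearMap.trace ℝ Plane M
      = M (EuclideanSpace.single 0 1) 0 + M (EuclideanSpace.single 1 1) 1 := by
  simp [LinearMap.trace_eq_sum_inner _ (EuclideanSpace.basisFun (Fin 2) ℝ), Fin.sum_univ_two,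
    EuclideanSpace.inner_single_left]

lemma abs_trace_le (M : Plane →L[ℝ] Plane) : |LinearMap.trace ℝ Plane M| ≤ 2 * ‖M‖ := by
  have hentry (i : Fin 2) : |M (EuclideanSpace.single i 1) i| ≤ ‖M‖ :=
    (PiLp.norm_apply_le _ i).trans (by simpa using M.le_opNorm (EuclideanSpace.single i 1))
  rw [trace_plane, two_mul]
  exact (abs_add_le _ _).trans (add_le_add (hentry 0) (hentry 1))

lemma continuous_trace : Continuous fun M : Plane →L[ℝ] Plane => LinearMap.trace ℝ Plane M := by
  simp only [trace_plane]
  fun_prop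

section

variable {a b c u : Plane × ℝ → ℝ} {x : Plane} {t : ℝ}

lemma deriv_slice (hu : DifferentiableAt ℝ u (x, t)) :
    deriv (fun s => u (x, s)) t = fderiv ℝ u (x, t) (0, 1) := by
  have := (HasFDerivAt.comp t (f := fun s : ℝ => (x, s)) hu.hasFDerivAt
    (hasFDerivAt_prodMk_right x t)).hasDerivAt.deriv
  simpa [Function.comp_def] using this

lemma lineDeriv_slice_mul (hc : DifferentiableAt ℝ c (x, t)) (hu : DifferentiableAt ℝ u (x, t))
    (v : Plane) : lineDeriv ℝ (fun y => c (y, t) * u (y, t)) x v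
      = c (x, t) * fderiv ℝ u (x, t) (v, 0) + u (x, t) * fderiv ℝ c (x, t) (v, 0) := by
  have hcx := HasFDerivAt.comp x (f := fun y : Plane => (y, t)) hc.hasFDerivAt
    (hasFDerivAt_prodMk_left x t)
  have hux := HasFDerivAt.comp x (f := fun y : Plane => (y, t)) hu.hasFDerivAt
    (hasFDerivAt_prodMk_left x t)
  simpa [Function.comp_def, Pi.mul_def] using ((hcx.mul hux).hasLineDerivAt v).lineDeriv

lemma differentiableAt_velocity {p : Plane × ℝ} (ha : DifferentiableAt ℝ a p)
    (hb : DifferentiableAt ℝ b p) : DifferentiableAt ℝ (velocity a b) p := by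
  refine differentiableAt_euclidean.2 fun i => ?_
  fin_cases i
  exacts [ha, hb]

lemma contDiffOn_velocity {n : WithTop ℕ∞} {U : Set (Plane × ℝ)} (ha : ContDiffOn ℝ n a U)
    (hb : ContDiffOn ℝ n b U) : ContDiffOn ℝ n (velocity a b) U :=
  contDiffOn_euclidean.2 fun i => by
    fin_cases i
    exacts [ha, hb]

lemma fderiv_velocity_apply {p : Plane × ℝ} (hA : DifferentiableAt ℝ (velocity a b) p)
    (v : Plane × ℝ) (i : Fin 2) :
    fderiv ℝ (velocity a b) p v i = fderiv ℝ (![a, b] i) p v := by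
  have hcoord : (![a, b] i) = fun q => velocity a b q i := by
    fin_cases i <;> rfl
  have := (EuclideanSpace.proj (𝕜 := ℝ) i).hasFDerivAt.comp p hA.hasFDerivAt
  rw [hcoord]
  exact congrArg (· v) this.fderiv.symm

lemma conservation_eq_advection_add_compression (ha : DifferentiableAt ℝ a (x, t))
    (hb : DifferentiableAt ℝ b (x, t)) (hu : DifferentiableAt ℝ u (x, t)) :
    deriv (fun s => u (x, s)) t
      + lineDeriv ℝ (fun y => a (y, t) * u (y, t)) x (EuclideanSpace.single 0 1)
      + lineDeriv ℝ (fun y => b (y, t) * u (y, t)) x (EuclideanSpace.single 1 1)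
    = fderiv ℝ u (x, t) (velocity a b (x, t), 1)
      + u (x, t) * LinearMap.trace ℝ Plane (spaceDeriv (velocity a b) (x, t)) := by
  have hA := differentiableAt_velocity ha hb
  have hdir : ((velocity a b (x, t), 1) : Plane × ℝ) =
      a (x, t) • (EuclideanSpace.single 0 1, 0) + b (x, t) • (EuclideanSpace.single 1 1, 0)
        + (0, 1) := by
    ext i
    · fin_cases i <;> simp [velocity]
    · simp
  have htrace : LinearMap.trace ℝ Plane (spaceDeriv (velocity a b) (x, t))
      = fderiv ℝ a (x, t) (EuclideanSpace.single 0 1, 0)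
        + fderiv ℝ b (x, t) (EuclideanSpace.single 1 1, 0) := by
    rw [trace_plane]
    simp [spaceDeriv, fderiv_velocity_apply hA]
  rw [deriv_slice hu, lineDeriv_slice_mul ha hu, lineDeriv_slice_mul hb hu, hdir, htrace]
  simp only [map_add, map_smul, smul_eq_mul]
  ring

end

variable {Ω : Set Plane} {T C : ℝ} {a b u : Plane × ℝ → ℝ}

/-- `f` has `n` continuous derivatives up to the boundary of the cylinder `closure Ω × [0, T]`: it
is `C^n` on some open neighbourhood of that cylinder. -/
def ContDiffOnCylinder (n : WithTop ℕ∞) (Ω : Set Plane) (T : ℝ) (f : Plane × ℝ → ℝ) : Prop :=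
  ∃ U : Set (Plane × ℝ), IsOpen U ∧ closure Ω ×ˢ Icc 0 T ⊆ U ∧ ContDiffOn ℝ n f U

lemma SmoothOnCylinder.contDiffOnCylinder {f : Plane × ℝ → ℝ} (hf : SmoothOnCylinder Ω T f)
    (n : ℕ) : ContDiffOnCylinder n Ω T f := by
  obtain ⟨U, hU, hΩU, hfU⟩ := hf
  exact ⟨U, hU, hΩU, hfU.of_le (mod_cast le_top)⟩

/-- Uniform bounds on the coefficients and on the exact solution over the space-time set `S`,
together with the transport equation on `S` in nonconservative form. -/
structure TransportBounds (S : Set (Plane × ℝ)) (A : Plane × ℝ → Plane) (u : Plane × ℝ → ℝ)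
    (C : ℝ) : Prop where
  one_le : 1 ≤ C
  velocity : TaylorBoundedOn A S C
  solution : TaylorBoundedOn u S C
  transport : ∀ p ∈ S,
    fderiv ℝ u p (A p, 1) + u p * LinearMap.trace ℝ Plane (spaceDeriv A p) = 0

lemma SolvesTransport.eq_zero_on_closure {U : Set (Plane × ℝ)} (hU : IsOpen U)
    (hΩU : closure Ω ×ˢ Icc 0 T ⊆ U) (ha : ContDiffOn ℝ 1 a U) (hb : ContDiffOn ℝ 1 b U)
    (hu : ContDiffOn ℝ 1 u U) (hpde : SolvesTransport Ω T a b u) :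
    ∀ p ∈ closure Ω ×ˢ Icc 0 T, fderiv ℝ u p (velocity a b p, 1)
      + u p * LinearMap.trace ℝ Plane (spaceDeriv (velocity a b) p) = 0 := by
  have hA : ContDiffOn ℝ 1 (velocity a b) U := contDiffOn_velocity ha hb
  have hDA : ContinuousOn (fderiv ℝ (velocity a b)) U := hA.continuousOn_fderiv_of_isOpen hU le_rfl
  have hcont : ContinuousOn (fun p => fderiv ℝ u p (velocity a b p, 1)
      + u p * LinearMap.trace ℝ Plane (spaceDeriv (velocity a b) p)) U :=
    ((hu.continuousOn_fderiv_of_isOpen hU le_rfl).clm_apply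
      (hA.continuousOn.prodMk continuousOn_const)).add
      (hu.continuousOn.mul (continuous_trace.comp_continuousOn (hDA.clm_comp continuousOn_const)))
  rintro ⟨x, t⟩ ⟨hx, ht⟩
  have hslice : ContinuousOn (fun y => fderiv ℝ u (y, t) (velocity a b (y, t), 1)
      + u (y, t) * LinearMap.trace ℝ Plane (spaceDeriv (velocity a b) (y, t))) (closure Ω) :=
    hcont.comp (by fun_prop) fun y hy => hΩU ⟨hy, ht⟩
  have hinside : EqOn (fun y => fderiv ℝ u (y, t) (velocity a b (y, t), 1)
      + u (y, t) * LinearMap.trace ℝ Plane (spaceDeriv (velocity a b) (y, t))) 0 Ω := fun y hy => by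
    have hmem : (y, t) ∈ closure Ω ×ˢ Icc 0 T := ⟨subset_closure hy, ht⟩
    have hdiff {f : Plane × ℝ → ℝ} (hf : ContDiffOn ℝ 1 f U) : DifferentiableAt ℝ f (y, t) :=
      (hf.contDiffAt (hU.mem_nhds (hΩU hmem))).differentiableAt one_ne_zero
    exact (conservation_eq_advection_add_compression (hdiff ha) (hdiff hb) (hdiff hu)).symm.trans
      (hpde y hy t ht)
  exact hinside.of_subset_closure hslice continuousOn_const subset_closure subset_rfl hx

lemma exists_transportBounds (hΩ : Bornology.IsBounded Ω) (ha : ContDiffOnCylinder 2 Ω T a)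
    (hb : ContDiffOnCylinder 2 Ω T b) (hu : ContDiffOnCylinder 2 Ω T u)
    (hpde : SolvesTransport Ω T a b u) :
    ∃ C, TransportBounds (closure Ω ×ˢ Icc 0 T) (velocity a b) u C := by
  obtain ⟨Ua, hUa, hSa, ha⟩ := ha
  obtain ⟨Ub, hUb, hSb, hb⟩ := hb
  obtain ⟨Uu, hUu, hSu, hu⟩ := hu
  have hU : IsOpen (Ua ∩ Ub ∩ Uu) := (hUa.inter hUb).inter hUu
  have hSU : closure Ω ×ˢ Icc 0 T ⊆ Ua ∩ Ub ∩ Uu := subset_inter (subset_inter hSa hSb) hSu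
  have hS : IsCompact (closure Ω ×ˢ Icc 0 T) := hΩ.isCompact_closure.prod isCompact_Icc
  replace ha : ContDiffOn ℝ 2 a (Ua ∩ Ub ∩ Uu) := ha.mono fun p hp => hp.1.1
  replace hb : ContDiffOn ℝ 2 b (Ua ∩ Ub ∩ Uu) := hb.mono fun p hp => hp.1.2
  replace hu : ContDiffOn ℝ 2 u (Ua ∩ Ub ∩ Uu) := hu.mono fun p hp => hp.2
  have h12 : (1 : WithTop ℕ∞) ≤ 2 := by norm_num
  obtain ⟨C, hC, hAC, huC⟩ := ((Filter.eventually_ge_atTop 1).and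
    ((eventually_taylorBoundedOn hS hU hSU (contDiffOn_velocity ha hb)).and
      (eventually_taylorBoundedOn hS hU hSU hu))).exists
  exact ⟨C, hC, hAC, huC,
    hpde.eq_zero_on_closure hU hSU (ha.of_le h12) (hb.of_le h12) (hu.of_le h12)⟩

end Transport

/-! ### Geometry of the cells -/

lemma volume_real_ball (x : Plane) {r : ℝ} (hr : 0 ≤ r) :
    volume.real (Metric.ball x r) = Real.pi * r ^ 2 := by
  simp [Measure.real, EuclideanSpace.volume_ball_fin_two, ENNReal.toReal_ofReal hr, mul_comm,
    Real.pi_pos.le]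

lemma volume_real_closedBall (x : Plane) {r : ℝ} (hr : 0 ≤ r) :
    volume.real (Metric.closedBall x r) = Real.pi * r ^ 2 := by
  simp [Measure.real, EuclideanSpace.volume_closedBall_fin_two, ENNReal.toReal_ofReal hr, mul_comm,
    Real.pi_pos.le]

lemma aedisjoint_of_convex_of_disjoint_interior {E : Type*} [NormedAddCommGroup E]
    [NormedSpace ℝ E] [MeasurableSpace E] [BorelSpace E] [FiniteDimensional ℝ E]
    (μ : Measure E) [μ.IsAddHaarMeasure] {s t : Set E} (hs : Convex ℝ s) (ht : Convex ℝ t)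
    (hst : Disjoint (interior s) (interior t)) : AEDisjoint μ s t := by
  refine measure_mono_null (fun x ⟨hxs, hxt⟩ => ?_)
    (measure_union_null (hs.addHaar_frontier μ) (ht.addHaar_frontier μ))
  by_contra hx
  rw [mem_union, not_or] at hx
  have interior_of_notMem_frontier {r : Set E} (hxr : x ∈ r) (h : x ∉ frontier r) :
      x ∈ interior r := by_contra fun hi => h ⟨subset_closure hxr, hi⟩
  exact disjoint_left.1 hst (interior_of_notMem_frontier hxs hx.1)
    (interior_of_notMem_frontier hxt hx.2)

namespace TriMesh

variable {J : ℕ} (M : TriMesh J) (j : Fin J)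

/-- The linear part of the affine parametrization `ξ ↦ v₁ + B ξ` of a cell over the reference
triangle. -/
def cellLin : Plane →L[ℝ] Plane :=
  (EuclideanSpace.proj 0 : Plane →L[ℝ] ℝ).smulRight (M.vert j 1 - M.vert j 0)
    + (EuclideanSpace.proj 1 : Plane →L[ℝ] ℝ).smulRight (M.vert j 2 - M.vert j 0)

lemma cellLin_apply (ξ : Plane) :
    M.cellLin j ξ = ξ 0 • (M.vert j 1 - M.vert j 0) + ξ 1 • (M.vert j 2 - M.vert j 0) := by
  simp [cellLin]

lemma node_eq (q : Fin 7) : M.node j q = M.vert j 0 + M.cellLin j (refNode q) := by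
  fin_cases q <;> simp [node, cellLin_apply, refNode, midpoint_eq_smul_add] <;> module

lemma vert_mem_cell (i : Fin 3) : M.vert j i ∈ M.cell j :=
  subset_convexHull ℝ _ (mem_range_self i)

lemma convex_cell : Convex ℝ (M.cell j) := convex_convexHull ℝ _

lemma cell_subset_image : M.cell j ⊆ (fun ξ => M.vert j 0 + M.cellLin j ξ) '' refTri := by
  refine convexHull_min ?_ ?_
  · rintro _ ⟨i, rfl⟩
    fin_cases i
    · exact ⟨refNode 0, refNode_mem_refTri 0, (M.node_eq j 0).symm⟩
    · exact ⟨refNode 1, refNode_mem_refTri 1, (M.node_eq j 1).symm⟩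
    · exact ⟨refNode 2, refNode_mem_refTri 2, (M.node_eq j 2).symm⟩
  · simpa only [image_image, ContinuousLinearMap.coe_coe] using
      (convex_refTri.linear_image (M.cellLin j).toLinearMap).translate (M.vert j 0)

lemma vert_add_cellLin_mem_cell {ξ : Plane} (hξ : ξ ∈ refTri) :
    M.vert j 0 + M.cellLin j ξ ∈ M.cell j := by
  obtain ⟨h0, h1, h2⟩ := hξ
  have hsum : M.vert j 0 + M.cellLin j ξ = ∑ i, ![1 - ξ 0 - ξ 1, ξ 0, ξ 1] i • M.vert j i := by
    simp only [cellLin_apply, Fin.sum_univ_three, Matrix.cons_val_zero, Matrix.cons_val_one,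
      Matrix.cons_val]
    module
  rw [hsum]
  refine (M.convex_cell j).sum_mem (fun i _ => ?_) ?_ fun i _ => M.vert_mem_cell j i
  · fin_cases i
    · change 0 ≤ 1 - ξ 0 - ξ 1
      linarith
    · exact h0
    · exact h1
  · simp only [Fin.sum_univ_three, Matrix.cons_val_zero, Matrix.cons_val_one, Matrix.cons_val]
    ring

lemma cell_eq_image : M.cell j = (fun ξ => M.vert j 0 + M.cellLin j ξ) '' refTri :=
  (M.cell_subset_image j).antisymm
    (image_subset_iff.2 fun _ hξ => M.vert_add_cellLin_mem_cell j hξ)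

lemma node_mem_cell (q : Fin 7) : M.node j q ∈ M.cell j := by
  rw [node_eq]
  exact M.vert_add_cellLin_mem_cell j (refNode_mem_refTri q)

lemma isCompact_cell : IsCompact (M.cell j) := by
  rw [cell_eq_image]
  exact isCompact_refTri.image (by fun_prop)

lemma measurableSet_cell : MeasurableSet (M.cell j) :=
  (M.isCompact_cell j).isClosed.measurableSet

lemma cellLin_injective : Function.Injective (M.cellLin j) := by
  refine (injective_iff_map_eq_zero _).2 fun ξ hξ => ?_
  have hind := (affineIndependent_iff_linearIndependent_vsub ℝ _ (0 : Fin 3)).1 (M.nondegenerate j)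
  have hcoord := Fintype.linearIndependent_iff.1
    (hind.comp (fun i : Fin 2 => (⟨i.succ, Fin.succ_ne_zero i⟩ : {i : Fin 3 // i ≠ 0}))
      fun i k h => Fin.succ_injective 2 (congrArg Subtype.val h)) (fun i => ξ i)
    (by simpa [Fin.sum_univ_two, cellLin_apply] using hξ)
  ext i
  exact hcoord i

lemma interior_cell_nonempty : (interior (M.cell j)).Nonempty :=
  interior_convexHull_nonempty_iff_affineSpan_eq_top.2
    ((M.nondegenerate j).affineSpan_eq_top_iff_card_eq_finrank_add_one.2 (by simp))

lemma diam_cell_le_size : Metric.diam (M.cell j) ≤ M.size :=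
  le_ciSup (f := fun j => Metric.diam (M.cell j)) (finite_range _).bddAbove j

lemma size_nonneg : 0 ≤ M.size := Real.iSup_nonneg fun _ => Metric.diam_nonneg

variable {M j} in
lemma norm_sub_le_size {x y : Plane} (hx : x ∈ M.cell j) (hy : y ∈ M.cell j) :
    ‖x - y‖ ≤ M.size := by
  rw [← dist_eq_norm]
  exact (Metric.dist_le_diam_of_mem (M.isCompact_cell j).isBounded hx hy).trans
    (M.diam_cell_le_size j)

include j in
lemma size_pos : 0 < M.size := by
  have hne : M.vert j 0 ≠ M.vert j 1 := (M.nondegenerate j).injective.ne (by decide)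
  exact (norm_pos_iff.2 (sub_ne_zero.2 hne)).trans_le
    (norm_sub_le_size (M.vert_mem_cell j 0) (M.vert_mem_cell j 1))

lemma norm_cellLin_apply_le (ξ : Plane) : ‖M.cellLin j ξ‖ ≤ 2 * M.size * ‖ξ‖ := by
  have hedge (i : Fin 2) (k : Fin 3) : ‖ξ i • (M.vert j k - M.vert j 0)‖ ≤ ‖ξ‖ * M.size := by
    rw [norm_smul]
    exact mul_le_mul (PiLp.norm_apply_le ξ i)
      (norm_sub_le_size (M.vert_mem_cell j k) (M.vert_mem_cell j 0)) (norm_nonneg _) (norm_nonneg _)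
  rw [cellLin_apply]
  linarith [norm_add_le_of_le (hedge 0 1) (hedge 1 2)]

lemma setIntegral_cell (f : Plane → ℝ) :
    ∫ x in M.cell j, f x
      = |(M.cellLin j).det| * ∫ ξ in refTri, f (M.vert j 0 + M.cellLin j ξ) := by
  rw [M.cell_eq_image, integral_image_eq_integral_abs_det_fderiv_smul volume
    isCompact_refTri.isClosed.measurableSet (f := fun ξ => M.vert j 0 + M.cellLin j ξ)
    (f' := fun _ => M.cellLin j)
    (fun ξ _ => ((M.cellLin j).hasFDerivAt.const_add _).hasFDerivWithinAt)
    (fun ξ _ ζ _ h => M.cellLin_injective j (add_left_cancel h)), ← integral_const_mul]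
  rfl

lemma volume_real_cell :
    volume.real (M.cell j) = |(M.cellLin j).det| * volume.real refTri := by
  simpa using M.setIntegral_cell j fun _ => 1

lemma volume_real_cell_le : volume.real (M.cell j) ≤ Real.pi * M.size ^ 2 := by
  rw [← volume_real_closedBall (M.vert j 0) M.size_nonneg]
  exact measureReal_mono
    (fun x hx => mem_closedBall_iff_norm.2 (norm_sub_le_size hx (M.vert_mem_cell j 0)))
    measure_closedBall_lt_top.ne

lemma setIntegral_eq_sum {D : Set Plane} (hD : MeasurableSet D) (hsub : D ⊆ M.region)
    {f : Plane → ℝ} (hf : IntegrableOn f D) :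
    ∫ x in D, f x = ∑ l, ∫ x in D ∩ M.cell l, f x := by
  have hU : ⋃ l, D ∩ M.cell l = D := by
    rw [← inter_iUnion]
    exact inter_eq_left.2 hsub
  have hae : Pairwise (Function.onFun (AEDisjoint volume) fun l => D ∩ M.cell l) := fun l k hlk =>
    (aedisjoint_of_convex_of_disjoint_interior volume (M.convex_cell l) (M.convex_cell k)
      (M.nonoverlapping hlk)).mono inter_subset_right inter_subset_right
  have := integral_iUnion_ae (fun l => (hD.inter (M.measurableSet_cell l)).nullMeasurableSet) hae
    (by rwa [hU])
  rwa [hU, tsum_fintype] at this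

variable {M} {σ : ℝ}

lemma IsQuasiUniform.exists_cellLin_eq (hM : M.IsQuasiUniform σ) {e : Plane}
    (he : ‖e‖ ≤ σ * M.size) : ∃ ζ : Plane, ‖ζ‖ ≤ 2 ∧ M.cellLin j ζ = e := by
  obtain ⟨c, hc⟩ := hM j
  have hc₀ : c ∈ M.cell j := hc (Metric.mem_closedBall_self ((norm_nonneg e).trans he))
  have hc₁ : c + e ∈ M.cell j := hc (by rwa [mem_closedBall_iff_norm, add_sub_cancel_left])
  obtain ⟨ξ₀, hξ₀, rfl⟩ := M.cell_subset_image j hc₀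
  obtain ⟨ξ₁, hξ₁, hξe⟩ := M.cell_subset_image j hc₁
  refine ⟨ξ₁ - ξ₀, ?_, ?_⟩
  · linarith [norm_sub_le ξ₁ ξ₀, norm_le_one_of_mem_refTri hξ₀, norm_le_one_of_mem_refTri hξ₁]
  · rw [map_sub]
    exact sub_eq_of_eq_add' (add_left_cancel (hξe.trans (add_assoc _ _ _)))

lemma IsQuasiUniform.le_norm_cellLin (hσ : 0 ≤ σ) (hM : M.IsQuasiUniform σ) (ξ : Plane) :
    σ * M.size / 2 * ‖ξ‖ ≤ ‖M.cellLin j ξ‖ := by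
  rcases eq_or_ne ξ 0 with rfl | hξ
  · simp
  have hy : 0 < ‖M.cellLin j ξ‖ :=
    norm_pos_iff.2 ((map_ne_zero_iff _ (M.cellLin_injective j)).2 hξ)
  have hr : 0 ≤ σ * M.size := mul_nonneg hσ M.size_nonneg
  set μ : ℝ := σ * M.size / ‖M.cellLin j ξ‖ with hlam
  have hlam0 : 0 ≤ μ := by positivity
  obtain ⟨ζ, hζ, he⟩ := hM.exists_cellLin_eq j (e := μ • M.cellLin j ξ)
    (by rw [norm_smul, Real.norm_of_nonneg hlam0, hlam, div_mul_cancel₀ _ hy.ne'])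
  obtain rfl : ζ = μ • ξ := M.cellLin_injective j (by rw [he, map_smul])
  rw [norm_smul, Real.norm_of_nonneg hlam0, hlam, div_mul_eq_mul_div, div_le_iff₀ hy] at hζ
  linarith

lemma IsQuasiUniform.le_volume_real_cell (hσ : 0 ≤ σ) (hM : M.IsQuasiUniform σ) :
    Real.pi * (σ * M.size) ^ 2 ≤ volume.real (M.cell j) := by
  obtain ⟨c, hc⟩ := hM j
  rw [← volume_real_closedBall c (mul_nonneg hσ M.size_nonneg)]
  exact measureReal_mono hc (M.isCompact_cell j).measure_lt_top.ne

lemma IsQuasiUniform.card_mul_le (hσ : 0 ≤ σ) (hM : M.IsQuasiUniform σ) {r : ℝ}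
    (hr : 0 ≤ r) (x : Plane) {s : Finset (Fin J)}
    (hs : ∀ l ∈ s, (M.cell l ∩ Metric.closedBall x (r * M.size)).Nonempty) :
    s.card * (σ * M.size) ^ 2 ≤ ((r + 1) * M.size) ^ 2 := by
  have hh := M.size_nonneg
  choose c hc using hM
  have hball (l) : Metric.ball (c l) (σ * M.size) ⊆ interior (M.cell l) :=
    interior_maximal (Metric.ball_subset_closedBall.trans (hc l)) Metric.isOpen_ball
  have hdisj : (s : Set (Fin J)).PairwiseDisjoint fun l => Metric.ball (c l) (σ * M.size) :=
    fun l _ k _ hlk => (M.nonoverlapping hlk).mono (hball l) (hball k)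
  have hsub : (⋃ l ∈ s, Metric.ball (c l) (σ * M.size))
      ⊆ Metric.closedBall x ((r + 1) * M.size) := by
    refine iUnion₂_subset fun l hl y hy => ?_
    obtain ⟨z, hz, hzx⟩ := hs l hl
    have hyz := norm_sub_le_size (interior_subset (hball l hy)) hz
    rw [mem_closedBall_iff_norm] at hzx ⊢
    linarith [norm_sub_le_norm_sub_add_norm_sub y z x]
  have hvol := measureReal_mono (μ := volume) hsub measure_closedBall_lt_top.ne
  rw [measureReal_biUnion_finset hdisj fun l _ => measurableSet_ball,
    volume_real_closedBall _ (by positivity),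
    Finset.sum_congr rfl fun l _ => volume_real_ball (c l) (mul_nonneg hσ hh),
    Finset.sum_const, nsmul_eq_mul, mul_left_comm] at hvol
  exact le_of_mul_le_mul_left hvol Real.pi_pos

lemma IsQuasiUniform.card_le (hσ : 0 < σ) (hM : M.IsQuasiUniform σ) {r : ℝ} (hr : 0 ≤ r)
    (x : Plane) {s : Finset (Fin J)}
    (hs : ∀ l ∈ s, (M.cell l ∩ Metric.closedBall x (r * M.size)).Nonempty) :
    (s.card : ℝ) ≤ ((r + 1) / σ) ^ 2 := by
  rcases s.eq_empty_or_nonempty with rfl | ⟨l, -⟩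
  · simpa using sq_nonneg ((r + 1) / σ)
  have hh := M.size_pos l
  have hcard := hM.card_mul_le hσ.le hr x hs
  rw [div_pow, le_div_iff₀ (by positivity)]
  refine le_of_mul_le_mul_right (a := M.size ^ 2) ?_ (by positivity)
  linarith [mul_pow σ M.size 2, mul_pow (r + 1) M.size 2, hcard]

end TriMesh

/-! ### The least-squares fit and the update -/

lemma exists_leastSquares {V F : Type*} [AddCommGroup V] [Module ℝ V] [FiniteDimensional ℝ V]
    [NormedAddCommGroup F] [InnerProductSpace ℝ F] (L : V →ₗ[ℝ] F) (hL : Function.Injective L) :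
    ∃ S : F →ₗ[ℝ] V, ∀ y v, (∀ w, ‖L v - y‖ ≤ ‖L w - y‖) ↔ v = S y := by
  let P : F →ₗ[ℝ] LinearMap.range L := (LinearMap.range L).orthogonalProjectionOnto.toLinearMap
  let e := LinearEquiv.ofInjective L hL
  refine ⟨e.symm.toLinearMap ∘ₗ P, fun y v => ?_⟩
  have pythagoras (w : V) : ‖L w - y‖ ^ 2 = ‖e w - P y‖ ^ 2 + ‖y - P y‖ ^ 2 := by
    have horth : inner ℝ (L w - P y) (P y - y) = 0 := by
      rw [← neg_sub y, inner_neg_right, real_inner_comm, neg_eq_zero]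
      exact Submodule.starProjection_inner_eq_zero y (L w - P y)
        (Submodule.sub_mem _ (LinearMap.mem_range_self L w) (P y).2)
    have := norm_add_sq_eq_norm_sq_add_norm_sq_real horth
    rw [sub_add_sub_cancel, ← sq, ← sq, ← sq, norm_sub_rev (P y : F)] at this
    exact this
  rw [LinearMap.comp_apply, LinearEquiv.coe_coe, LinearEquiv.eq_symm_apply]
  refine ⟨fun h => ?_, fun h w => ?_⟩
  · have hmin := pow_le_pow_left₀ (norm_nonneg _) (h (e.symm (P y))) 2
    rw [pythagoras, pythagoras, LinearEquiv.apply_symm_apply, sub_self, norm_zero] at hmin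
    have : ‖e v - P y‖ = 0 := by nlinarith [norm_nonneg (e v - P y)]
    exact sub_eq_zero.1 (norm_eq_zero.1 this)
  · refine le_of_sq_le_sq ?_ (norm_nonneg _)
    rw [pythagoras, pythagoras, h, sub_self, norm_zero]
    nlinarith [sq_nonneg ‖e w - P y‖]

lemma bijective_of_anisotropic {k V : Type*} [Field k] [AddCommGroup V] [Module k V]
    [FiniteDimensional k V] (B : V →ₗ[k] Module.Dual k V) (hB : ∀ v, B v v = 0 → v = 0) :
    Function.Bijective B := by
  have hinj : Function.Injective B :=
    (injective_iff_map_eq_zero B).2 fun v hv => hB v (by rw [hv, LinearMap.zero_apply])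
  exact ⟨hinj, (LinearMap.injective_iff_surjective_of_finrank_eq_finrank
    Subspace.dual_finrank_eq.symm).1 hinj⟩

/-- The vector of the values of a polynomial at finitely many points. -/
def evalAt {ι : Type*} {k : ℕ} (x : ι → Plane) : Poly k →ₗ[ℝ] EuclideanSpace ℝ ι where
  toFun p := WithLp.toLp 2 fun q => pval p (x q)
  map_add' p q := by ext; simp
  map_smul' r p := by ext; simp

section Fit

variable {J : ℕ} (M : TriMesh J) (Φ : Plane → Plane) (j : Fin J)

lemma isLeastSquaresFit_iff_norm_le (Ψ ψ : Poly 2) : IsLeastSquaresFit M Φ j Ψ ψ ↔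
    ∀ χ : Poly 2, ‖evalAt (fun q => Φ (M.node j q)) ψ - evalAt (M.node j) Ψ‖
      ≤ ‖evalAt (fun q => Φ (M.node j q)) χ - evalAt (M.node j) Ψ‖ := by
  refine forall_congr' fun χ => ?_
  rw [← sq_le_sq₀ (norm_nonneg _) (norm_nonneg _), EuclideanSpace.real_norm_sq_eq,
    EuclideanSpace.real_norm_sq_eq]
  rfl

/-- The traced nodes of the `j`-th cell determine quadratic polynomials. -/
def Unisolvent : Prop := ∀ ψ : Poly 2, (∀ q, pval ψ (Φ (M.node j q)) = 0) → ψ = 0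

variable {M Φ j}

lemma Unisolvent.exists_fit (h : Unisolvent M Φ j) :
    ∃ S : Poly 2 →ₗ[ℝ] Poly 2, ∀ Ψ ψ, IsLeastSquaresFit M Φ j Ψ ψ ↔ ψ = S Ψ := by
  obtain ⟨S, hS⟩ := exists_leastSquares (evalAt (k := 2) fun q => Φ (M.node j q))
    ((injective_iff_map_eq_zero _).2 fun ψ hψ => h ψ fun q => congrArg (fun v => v q) hψ)
  refine ⟨S ∘ₗ evalAt (M.node j), fun Ψ ψ => ?_⟩
  rw [isLeastSquaresFit_iff_norm_le]
  exact hS _ _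

end Fit

lemma integrableOn_pval_mul_pval {k l : ℕ} {D : Set Plane} (hD : Bornology.IsBounded D)
    (p : Poly k) (q : Poly l) : IntegrableOn (fun x => pval p x * pval q x) D :=
  (((continuous_pval p).mul (continuous_pval q)).continuousOn.integrableOn_compact
    hD.isCompact_closure).mono_set subset_closure

/-- The bilinear form `(p, q) ↦ ∫_D p q` on polynomials. -/
def massForm (k : ℕ) {D : Set Plane} (hD : Bornology.IsBounded D) :
    Poly k →ₗ[ℝ] Module.Dual ℝ (Poly k) :=
  LinearMap.mk₂ ℝ (fun p q => ∫ x in D, pval p x * pval q x)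
    (fun p p' q => by
      simpa only [pval_add, add_mul] using integral_add (integrableOn_pval_mul_pval hD p q)
        (integrableOn_pval_mul_pval hD p' q))
    (fun r p q => by simp only [pval_smul, mul_assoc, integral_const_mul, smul_eq_mul])
    (fun p q q' => by
      simpa only [pval_add, mul_add] using integral_add (integrableOn_pval_mul_pval hD p q)
        (integrableOn_pval_mul_pval hD p q'))
    (fun r p q => by simp only [pval_smul, mul_left_comm, integral_const_mul, smul_eq_mul])

namespace TriMesh

variable {J : ℕ} (M : TriMesh J)

lemma isBounded_inter_cell (S : Set Plane) (j : Fin J) : Bornology.IsBounded (S ∩ M.cell j) :=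
  (M.isCompact_cell j).isBounded.subset inter_subset_right

/-- The functional `ψ ↦ ∫_S v ψ` of the scheme. -/
def remapForm (S : Set Plane) (v : M.DGSpace 2) : Module.Dual ℝ (Poly 2) :=
  ∑ l, massForm 2 (M.isBounded_inter_cell S l) (v l)

lemma remapForm_apply (S : Set Plane) (v : M.DGSpace 2) (ψ : Poly 2) :
    M.remapForm S v ψ = remapIntegral M S v ψ :=
  LinearMap.sum_apply _ _ _

lemma eqOn_zero_of_massForm_self (j : Fin J) {p : Poly 2}
    (hp : massForm 2 (M.isCompact_cell j).isBounded p p = 0) : EqOn (pval p) 0 (M.cell j) :=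
  eqOn_zero_of_setIntegral_mul_self_eq_zero (M.isCompact_cell j)
    ((M.convex_cell j).closure_interior_eq_closure_of_nonempty_interior
      (M.interior_cell_nonempty j) ▸ subset_closure) (continuous_pval p) hp

end TriMesh

lemma eq_zero_of_pullback_eq_zero {k : ℕ} {w : Plane} {H : Plane →L[ℝ] Plane}
    (hH : Function.Injective H) {p : Poly k} (hp : pullback w H p = 0) : p = 0 := by
  refine pval_injective (funext fun x => ?_)
  obtain ⟨ξ, hξ⟩ := (LinearMap.injective_iff_surjective (f := H.toLinearMap)).1 hH (x - w)
  have hx : w + H ξ = x := by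
    rw [← ContinuousLinearMap.coe_coe, hξ, add_sub_cancel]
  rw [← hx, ← pval_pullback, hp]
  simp only [pval_zero]

lemma TriMesh.eq_zero_of_massForm_self {J : ℕ} (M : TriMesh J) (j : Fin J) {p : Poly 2}
    (hp : massForm 2 (M.isCompact_cell j).isBounded p p = 0) : p = 0 := by
  refine eq_zero_of_pullback_eq_zero (w := M.vert j 0) (M.cellLin_injective j)
    (eq_zero_of_nodalNorm_eq_zero (norm_eq_zero.2 (funext fun i => ?_)))
  rw [pval_pullback, ← M.node_eq]
  exact M.eqOn_zero_of_massForm_self j hp (M.node_mem_cell j _)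

lemma Unisolvent.exists_update {J : ℕ} {M : TriMesh J} {Φ : Plane → Plane} {j : Fin J}
    (h : Unisolvent M Φ j) (uOld : M.DGSpace 2) :
    ∃ p : Poly 2, ∀ p', IsUpdate M Φ uOld j p' ↔ p' = p := by
  obtain ⟨S, hS⟩ := h.exists_fit
  let e := LinearEquiv.ofBijective (massForm 2 (M.isCompact_cell j).isBounded)
    (bijective_of_anisotropic _ fun p => M.eq_zero_of_massForm_self j)
  refine ⟨e.symm (M.remapForm (upstream M Φ j) uOld ∘ₗ S), fun p' => ?_⟩
  rw [LinearEquiv.eq_symm_apply, LinearMap.ext_iff]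
  refine forall_congr' fun Ψ => ?_
  simp only [hS, forall_eq, LinearMap.comp_apply, TriMesh.remapForm_apply]
  rfl

/-! ### The traced element -/

section Determinant

variable (P : Plane →L[ℝ] Plane)

lemma det_plane : P.det
    = P (EuclideanSpace.single 0 1) 0 * P (EuclideanSpace.single 1 1) 1
      - P (EuclideanSpace.single 1 1) 0 * P (EuclideanSpace.single 0 1) 1 := by
  have h : P.det = LinearMap.det (P : Plane →ₗ[ℝ] Plane) := rfl
  rw [h, ← LinearMap.det_toMatrix (EuclideanSpace.basisFun (Fin 2) ℝ).toBasis, Matrix.det_fin_two]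
  simp [LinearMap.toMatrix_apply]

lemma det_id_add : (ContinuousLinearMap.id ℝ Plane + P).det
    = 1 + LinearMap.trace ℝ Plane P + P.det := by
  rw [det_plane, det_plane, trace_plane]
  simp
  ring

lemma abs_det_le : |P.det| ≤ 2 * ‖P‖ ^ 2 := by
  have hentry (i k : Fin 2) : |P (EuclideanSpace.single i 1) k| ≤ ‖P‖ :=
    (PiLp.norm_apply_le _ k).trans (by simpa using P.le_opNorm (EuclideanSpace.single i 1))
  have hprod (i k i' k' : Fin 2) :
      |P (EuclideanSpace.single i 1) k * P (EuclideanSpace.single i' 1) k'| ≤ ‖P‖ * ‖P‖ := by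
    rw [abs_mul]
    exact mul_le_mul (hentry i k) (hentry i' k') (abs_nonneg _) (norm_nonneg P)
  rw [det_plane]
  linarith [abs_sub (P (EuclideanSpace.single 0 1) 0 * P (EuclideanSpace.single 1 1) 1)
    (P (EuclideanSpace.single 1 1) 0 * P (EuclideanSpace.single 0 1) 1), hprod 0 0 1 1,
    hprod 1 0 0 1]

variable {P} (hP : 2 * ‖P‖ ≤ 1)
include hP

lemma abs_abs_det_id_add_sub_le :
    |(|(ContinuousLinearMap.id ℝ Plane + P).det|) - (1 + LinearMap.trace ℝ Plane P)|
      ≤ 2 * ‖P‖ ^ 2 := by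
  have htrace : 0 ≤ 1 + LinearMap.trace ℝ Plane P := by
    linarith [neg_abs_le (LinearMap.trace ℝ Plane P), abs_trace_le P]
  calc |(|(ContinuousLinearMap.id ℝ Plane + P).det|) - (1 + LinearMap.trace ℝ Plane P)|
      ≤ |(ContinuousLinearMap.id ℝ Plane + P).det - (1 + LinearMap.trace ℝ Plane P)| := by
        simpa only [abs_of_nonneg htrace] using abs_abs_sub_abs_le
          (ContinuousLinearMap.id ℝ Plane + P).det (1 + LinearMap.trace ℝ Plane P)
    _ = |P.det| := by rw [det_id_add, add_sub_cancel_left]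
    _ ≤ 2 * ‖P‖ ^ 2 := abs_det_le P

lemma abs_abs_det_id_add_sub_one_le :
    |(|(ContinuousLinearMap.id ℝ Plane + P).det|) - 1| ≤ 3 * ‖P‖ := by
  have hdet := abs_abs_det_id_add_sub_le hP
  have htrace := abs_trace_le P
  have hsq : 2 * ‖P‖ ^ 2 ≤ ‖P‖ := by nlinarith [norm_nonneg P]
  rw [abs_le] at hdet htrace ⊢
  constructor <;> linarith

end Determinant

lemma exists_inverse {E : Type*} [NormedAddCommGroup E] [NormedSpace ℝ E] [FiniteDimensional ℝ E]
    {H : E →L[ℝ] E} (hH : Function.Injective H) :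
    ∃ K : E →L[ℝ] E, (∀ x, K (H x) = x) ∧ ∀ x, H (K x) = x := by
  let e := LinearEquiv.ofInjectiveEndo H.toLinearMap hH
  exact ⟨LinearMap.toContinuousLinearMap e.symm.toLinearMap, e.symm_apply_apply,
    e.apply_symm_apply⟩

/-- The traced nodes of the `j`-th cell are the images under the affine map `ξ ↦ w + H ξ` of the
reference nodes, displaced by at most `ε`. -/
structure Traced {J : ℕ} (M : TriMesh J) (Φ : Plane → Plane) (j : Fin J) (w : Plane)
    (H : Plane →L[ℝ] Plane) (ρ : Fin 7 → Plane) (ε : ℝ) : Prop where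
  injective : Function.Injective H
  node_eq : ∀ q, Φ (M.node j q) = w + H (refNode q + ρ q)
  norm_le : ∀ q, ‖ρ q‖ ≤ ε
  eps_le : 2 * (lebesgueConst * ε) ≤ 1

namespace Traced

variable {J : ℕ} {M : TriMesh J} {Φ : Plane → Plane} {j : Fin J} {w : Plane}
  {H : Plane →L[ℝ] Plane} {ρ : Fin 7 → Plane} {ε : ℝ}

lemma isoMap_eq (h : Traced M Φ j w H ρ ε) (ξ : Plane) :
    isoMap (fun i : Fin 6 => Φ (M.node j i.castSucc)) (ξ 0, ξ 1) = w + H (perturb ρ ξ) := by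
  calc isoMap (fun i : Fin 6 => Φ (M.node j i.castSucc)) (ξ 0, ξ 1)
      = ∑ i, shapeFun i ξ • (w + H (refNode (Fin.castSucc i) + ρ (Fin.castSucc i))) := by
        simp only [isoMap, h.node_eq, shapeFun]
    _ = w + H (perturb ρ ξ) := by
        simp only [smul_add, Finset.sum_add_distrib, ← Finset.sum_smul, sum_shapeFun, one_smul,
          map_add, ← map_smul, ← map_sum, perturb, sum_shapeFun_smul_refNode]

lemma upstream_eq (h : Traced M Φ j w H ρ ε) :
    upstream M Φ j = (fun ξ => w + H (perturb ρ ξ)) '' refTri := by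
  apply Subset.antisymm
  · rintro _ ⟨⟨x, y⟩, hξ, rfl⟩
    exact ⟨!₂[x, y], by simpa [refTri, refTriangle] using hξ, by
      simpa using (h.isoMap_eq !₂[x, y]).symm⟩
  · rintro _ ⟨ξ, hξ, rfl⟩
    exact ⟨(ξ 0, ξ 1), hξ, h.isoMap_eq ξ⟩

lemma isCompact_upstream (h : Traced M Φ j w H ρ ε) : IsCompact (upstream M Φ j) := by
  rw [h.upstream_eq]
  exact isCompact_refTri.image (by fun_prop)

lemma setIntegral_upstream (h : Traced M Φ j w H ρ ε) (f : Plane → ℝ) :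
    ∫ x in upstream M Φ j, f x = |H.det| * ∫ ξ in refTri,
      |(ContinuousLinearMap.id ℝ Plane + perturbDeriv ρ ξ).det| * f (w + H (perturb ρ ξ)) := by
  have hinj : InjOn (fun ξ => w + H (perturb ρ ξ)) refTri := fun ξ hξ ζ hζ hξζ =>
    injOn_perturb h.norm_le (by linarith [h.eps_le]) (refTri_subset_closedBall hξ)
      (refTri_subset_closedBall hζ) (h.injective (add_left_cancel hξζ))
  have hdet (ξ : Plane) : (H.comp (ContinuousLinearMap.id ℝ Plane + perturbDeriv ρ ξ)).det
      = H.det * (ContinuousLinearMap.id ℝ Plane + perturbDeriv ρ ξ).det :=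
    LinearMap.det_comp _ _
  rw [h.upstream_eq, integral_image_eq_integral_abs_det_fderiv_smul volume
    isCompact_refTri.measurableSet
    (f := fun ξ => w + H (perturb ρ ξ))
    (f' := fun ξ => H.comp (ContinuousLinearMap.id ℝ Plane + perturbDeriv ρ ξ))
    (fun ξ _ => ((H.hasFDerivAt.comp ξ (hasFDerivAt_perturb ρ ξ)).const_add _).hasFDerivWithinAt)
    hinj, ← integral_const_mul]
  simp only [hdet, abs_mul, smul_eq_mul, mul_assoc]

lemma perturb_mem_closedBall (h : Traced M Φ j w H ρ ε) {ξ : Plane} (hξ : ξ ∈ refTri) :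
    perturb ρ ξ ∈ Metric.closedBall 0 2 := by
  rw [mem_closedBall_zero_iff]
  linarith [norm_le_one_of_mem_refTri hξ, h.eps_le, norm_le_norm_add_norm_sub' (perturb ρ ξ) ξ,
    norm_perturb_sub_le h.norm_le (refTri_subset_closedBall hξ)]

lemma nodalNorm_fit_sub_le (h : Traced M Φ j w H ρ ε) {Ψ ψ : Poly 2}
    (hfit : IsLeastSquaresFit M Φ j Ψ ψ) :
    nodalNorm (pullback w H ψ - pullback (M.vert j 0) (M.cellLin j) Ψ)
      ≤ 2 * (√7 + 1) * lebesgueConst * ε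
        * nodalNorm (pullback (M.vert j 0) (M.cellLin j) Ψ) := by
  obtain ⟨K, hKH, -⟩ := exists_inverse h.injective
  refine SLDG.nodalNorm_fit_sub_le h.norm_le h.eps_le ?_
  -- The competitor in the least-squares problem is `Ψ` transported by the affine map itself.
  have := hfit (pullback (-K w) K (pullback (M.vert j 0) (M.cellLin j) Ψ))
  simp only [h.node_eq, pval_pullback, map_add K, hKH, neg_add_cancel_left] at this
  simpa only [M.node_eq, pval_pullback] using this

lemma unisolvent (h : Traced M Φ j w H ρ ε) : Unisolvent M Φ j := by
  intro ψ hψ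
  have hfit : IsLeastSquaresFit M Φ j 0 ψ := fun χ => by
    simpa [hψ] using Finset.sum_nonneg fun q _ => sq_nonneg (pval χ (Φ (M.node j q)))
  have hzero : pullback (M.vert j 0) (M.cellLin j) (0 : Poly 2) = 0 :=
    pval_injective (funext fun x => by simp)
  have hnorm : nodalNorm 0 = 0 := by simp [nodalNorm, ← Pi.zero_def]
  have hbound := h.nodalNorm_fit_sub_le hfit
  rw [hzero, sub_zero, hnorm, mul_zero] at hbound
  exact eq_zero_of_pullback_eq_zero h.injective
    (eq_zero_of_nodalNorm_eq_zero (hbound.antisymm (nodalNorm_nonneg _)))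

lemma abs_fit_le (h : Traced M Φ j w H ρ ε) {Ψ ψ : Poly 2}
    (hfit : IsLeastSquaresFit M Φ j Ψ ψ) {x : Plane} (hx : x ∈ upstream M Φ j) :
    |pval ψ x|
      ≤ (√7 + 2) * lebesgueConst * nodalNorm (pullback (M.vert j 0) (M.cellLin j) Ψ) := by
  rw [h.upstream_eq] at hx
  obtain ⟨ξ, hξ, rfl⟩ := hx
  set F := pullback (M.vert j 0) (M.cellLin j) Ψ
  have hm : 0 ≤ nodalNorm F := nodalNorm_nonneg F
  have hmem := h.perturb_mem_closedBall hξ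
  have hdiff : nodalNorm (pullback w H ψ - F) ≤ (√7 + 1) * nodalNorm F := by
    refine (h.nodalNorm_fit_sub_le hfit).trans (mul_le_mul_of_nonneg_right ?_ hm)
    nlinarith [h.eps_le, Real.sqrt_nonneg 7]
  calc |pval ψ (w + H (perturb ρ ξ))|
      = |pval F (perturb ρ ξ) + pval (pullback w H ψ - F) (perturb ρ ξ)| := by simp
    _ ≤ lebesgueConst * nodalNorm F + lebesgueConst * ((√7 + 1) * nodalNorm F) :=
        (abs_add_le _ _).trans <| add_le_add (abs_pval_le F hmem) <|
          (abs_pval_le _ hmem).trans (mul_le_mul_of_nonneg_left hdiff lebesgueConst_pos.le)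
    _ = (√7 + 2) * lebesgueConst * nodalNorm F := by ring

end Traced

lemma exists_traced_of_norm_sub_le {J : ℕ} {M : TriMesh J} {Φ : Plane → Plane} {j : Fin J}
    {w : Plane} {H : Plane →L[ℝ] Plane} {m e : ℝ} (hm : 0 < m) (hH : ∀ ξ, m * ‖ξ‖ ≤ ‖H ξ‖)
    (hΦ : ∀ q, ‖Φ (M.node j q) - (w + H (refNode q))‖ ≤ e)
    (hε : 2 * (lebesgueConst * (e / m)) ≤ 1) : ∃ ρ, Traced M Φ j w H ρ (e / m) := by
  have hinj : Function.Injective H := (injective_iff_map_eq_zero _).2 fun ξ hξ => by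
    have := hH ξ
    rw [hξ, norm_zero] at this
    exact norm_eq_zero.1 (le_antisymm (nonpos_of_mul_nonpos_right this hm) (norm_nonneg ξ))
  obtain ⟨K, -, hHK⟩ := exists_inverse hinj
  refine ⟨fun q => K (Φ (M.node j q) - w) - refNode q, hinj, fun q => ?_, fun q => ?_, hε⟩
  · rw [add_sub_cancel, hHK, add_sub_cancel]
  · rw [le_div_iff₀' hm]
    refine (hH _).trans ?_
    rw [map_sub H, hHK, sub_sub]
    exact hΦ q

lemma half_norm_le_norm_stepLin {E : Type*} [NormedAddCommGroup E] [NormedSpace ℝ E]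
    {A : E × ℝ → E} {p : E × ℝ} {Δ : ℝ} (hΔ : 2 * ‖Δ • spaceDeriv A p‖ ≤ 1) (y : E) :
    ‖y‖ / 2 ≤ ‖stepLin A p Δ y‖ := by
  have hsmall : ‖(Δ • spaceDeriv A p) y‖ ≤ 1 / 2 * ‖y‖ :=
    ContinuousLinearMap.le_of_opNorm_le _ (by linarith) y
  have hsub : ‖y‖ - ‖(Δ • spaceDeriv A p) y‖ ≤ ‖stepLin A p Δ y‖ := norm_sub_norm_le _ _
  linarith

lemma TaylorBoundedOn.two_mul_norm_smul_spaceDeriv_le {E : Type*} [NormedAddCommGroup E]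
    [NormedSpace ℝ E] {A : E × ℝ → E} {S : Set (E × ℝ)} {C Δ : ℝ} {p : E × ℝ}
    (hA : TaylorBoundedOn A S C) (hp : p ∈ S) (hΔ : 0 ≤ Δ) (hΔC : 2 * (Δ * C) ≤ 1) :
    2 * ‖Δ • spaceDeriv A p‖ ≤ 1 := by
  rw [norm_smul, Real.norm_of_nonneg hΔ]
  have := mul_le_mul_of_nonneg_left ((norm_spaceDeriv_le A p).trans (hA.norm_fderiv_le p hp)) hΔ
  linarith

/-- The constant in the `O(h³)` distance between the traced nodes and the affine approximation of
the backward flow, for velocity fields bounded by `C`, time steps `Δt ≤ c h` and tracing errors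
`κ Δt³`. -/
def tracingConst (C c κ : ℝ) : ℝ := 2 * C ^ 2 * ((C + 1) * c + 1) * c ^ 2 + c * C + |κ| * c ^ 3

section Tracing

variable {Ω : Set Plane} {S : Set (Plane × ℝ)} {a b : Plane × ℝ → ℝ} {C c κ s t : ℝ} {J : ℕ}
  {M : TriMesh J} {Φ : Plane → Plane} {j : Fin J}

lemma TracingAccurate.norm_sub_le (htr : TracingAccurate M Ω a b s t κ Φ)
    (hA : TaylorBoundedOn (velocity a b) S C) (hC : 1 ≤ C) (hΩS : closure Ω ×ˢ Icc s t ⊆ S)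
    (hcell : M.cell j ⊆ closure Ω) (hst : s ≤ t) (hΔ : t - s ≤ c * M.size)
    (hin : ∀ x ∈ M.cell j, ∃ y, IsFoot Ω a b s t x y) (q : Fin 7) :
    ‖Φ (M.node j q) - (stepBase (velocity a b) (M.vert j 0, t) (t - s)
      + stepLin (velocity a b) (M.vert j 0, t) (t - s) (M.cellLin j (refNode q)))‖
      ≤ tracingConst C c κ * M.size ^ 3 := by
  have hh : 0 ≤ M.size := M.size_nonneg
  have hΔ0 : 0 ≤ t - s := sub_nonneg.2 hst
  have hc : 0 ≤ c * M.size := hΔ0.trans hΔ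
  have hnode := M.node_mem_cell j q
  obtain ⟨y, hy⟩ := hin _ hnode
  have htrace : ‖Φ (M.node j q) - y‖ ≤ |κ| * (t - s) ^ 3 := by
    rw [← dist_eq_norm]
    exact (htr j q y hy).trans (mul_le_mul_of_nonneg_right (le_abs_self κ) (by positivity))
  obtain ⟨γ, hγ, hγt, hγs⟩ := hy
  have hfoot := norm_foot_sub_le hA hC hst (γ := γ) (x₀ := M.vert j 0) (h := M.size)
    (fun τ hτ => hΩS ⟨(hγ τ hτ).1, hτ⟩) (fun τ hτ => (hγ τ hτ).2)
    (hΩS ⟨hcell (M.vert_mem_cell j 0), right_mem_Icc.2 hst⟩)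
    (hγt ▸ TriMesh.norm_sub_le_size hnode (M.vert_mem_cell j 0))
  rw [hγt, M.node_eq, add_sub_cancel_left, hγs] at hfoot
  refine (norm_sub_le_norm_sub_add_norm_sub _ y _).trans ((add_le_add htrace hfoot).trans ?_)
  calc |κ| * (t - s) ^ 3 + (2 * C ^ 2 * ((C + 1) * (t - s) + M.size) * (t - s) ^ 2
          + (t - s) * (C * M.size ^ 2))
      ≤ |κ| * (c * M.size) ^ 3 + (2 * C ^ 2 * ((C + 1) * (c * M.size) + M.size)
          * (c * M.size) ^ 2 + c * M.size * (C * M.size ^ 2)) := by gcongr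
    _ = tracingConst C c κ * M.size ^ 3 := by rw [tracingConst]; ring

/-- Third-order accurate tracing displaces the reference nodes by `O(h²)`, because the affine
approximation of the backward flow contracts the reference triangle only by a factor `h`. -/
lemma TracingAccurate.exists_traced (htr : TracingAccurate M Ω a b s t κ Φ)
    (hA : TaylorBoundedOn (velocity a b) S C) (hC : 1 ≤ C) (hΩS : closure Ω ×ˢ Icc s t ⊆ S)
    (hcell : M.cell j ⊆ closure Ω) (hst : s ≤ t) (hΔ : t - s ≤ c * M.size)
    (hin : ∀ x ∈ M.cell j, ∃ y, IsFoot Ω a b s t x y) {σ : ℝ} (hσ : 0 < σ)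
    (hM : M.IsQuasiUniform σ) (hΔC : 2 * ((t - s) * C) ≤ 1)
    (hε : 2 * (lebesgueConst * (4 / σ * tracingConst C c κ * M.size ^ 2)) ≤ 1) :
    ∃ ρ, Traced M Φ j (stepBase (velocity a b) (M.vert j 0, t) (t - s))
      ((stepLin (velocity a b) (M.vert j 0, t) (t - s)).comp (M.cellLin j)) ρ
      (4 / σ * tracingConst C c κ * M.size ^ 2) := by
  have hh : 0 < M.size := M.size_pos j
  have hratio : 4 / σ * tracingConst C c κ * M.size ^ 2
      = tracingConst C c κ * M.size ^ 3 / (σ * M.size / 4) := by field_simp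
  have hbase : (M.vert j 0, t) ∈ S := hΩS ⟨hcell (M.vert_mem_cell j 0), right_mem_Icc.2 hst⟩
  rw [hratio] at hε ⊢
  refine exists_traced_of_norm_sub_le (by positivity) (fun ξ => ?_)
    (htr.norm_sub_le hA hC hΩS hcell hst hΔ hin) hε
  have hcellLin := TriMesh.IsQuasiUniform.le_norm_cellLin j hσ.le hM ξ
  have hstep := half_norm_le_norm_stepLin
    (hA.two_mul_norm_smul_spaceDeriv_le hbase (sub_nonneg.2 hst) hΔC) (M.cellLin j ξ)
  rw [ContinuousLinearMap.comp_apply]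
  linarith

end Tracing

/-! ### Consistency with the transport equation -/

open Asymptotics

section Asymptotics

variable {α E F : Type*} [NormedAddCommGroup E] [NormedAddCommGroup F] {l : Filter α}

lemma isBigO_of_norm_le_mul {f : α → E} {g : α → ℝ} {k : ℝ} (hf : ∀ i, ‖f i‖ ≤ k * g i) :
    f =O[l] g :=
  (IsBigO.of_norm_le hf).trans (isBigO_const_mul_self k g l)

lemma isBigO_one_of_norm_le {f : α → E} {k : ℝ} (hf : ∀ i, ‖f i‖ ≤ k) :
    f =O[l] fun _ => (1 : ℝ) :=
  isBigO_of_norm_le_mul fun i => (hf i).trans_eq (mul_one k).symm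

variable [NormedSpace ℝ E] [NormedSpace ℝ F]

lemma isBigO_apply {T : α → E →L[ℝ] F} {v : α → E} {f g : α → ℝ} (hT : T =O[l] f)
    (hv : v =O[l] g) : (fun i => T i (v i)) =O[l] fun i => f i * g i :=
  isBoundedBilinearMap_apply.isBigO_comp.trans (hT.norm_left.mul hv.norm_left)

/-- Up to second order the solution loses `Δ K` and the area `Δ d` during a step, and the transport
equation `K + U d = O(h)` makes the two losses cancel in the product. -/
lemma isBigO_product_sub {U K d X Y Z W V Δ h m : α → ℝ} (hh : h =O[l] fun _ => (1 : ℝ))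
    (hΔ : Δ =O[l] h) (hU : U =O[l] fun _ => (1 : ℝ)) (hK : K =O[l] fun _ => (1 : ℝ))
    (hd : d =O[l] fun _ => (1 : ℝ)) (hbal : (fun i => K i + U i * d i) =O[l] h)
    (hX : (fun i => X i - (U i - Δ i * K i)) =O[l] fun i => h i ^ 2)
    (hY : (fun i => Y i - (1 - Δ i * d i)) =O[l] fun i => h i ^ 2)
    (hZ : (fun i => Z i - 1) =O[l] fun i => h i ^ 2)
    (hW : (fun i => W i - V i) =O[l] fun i => h i ^ 2 * m i) (hV : V =O[l] m) :
    (fun i => X i * Y i * Z i * W i - U i * V i) =O[l] fun i => h i ^ 2 * m i := by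
  have hone {f g k : α → ℝ} (hf : f =O[l] fun _ => (1 : ℝ)) (hg : g =O[l] k) :
      (fun i => f i * g i) =O[l] k := by simpa only [one_mul] using hf.mul hg
  have hh2 : (fun i => h i ^ 2) =O[l] fun _ => (1 : ℝ) := by simpa only [one_pow] using hh.pow 2
  have hΔ1 := hΔ.trans hh
  have hΔd : (fun i => 1 - Δ i * d i) =O[l] fun _ => (1 : ℝ) :=
    (isBigO_refl _ _).sub (hone hΔ1 hd)
  have hX1 : X =O[l] fun _ => (1 : ℝ) := by
    simpa using (hX.trans hh2).add (hU.sub (hone hΔ1 hK))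
  have hY1 : Y =O[l] fun _ => (1 : ℝ) := by simpa using (hY.trans hh2).add hΔd
  have hZ1 : Z =O[l] fun _ => (1 : ℝ) := by
    simpa using (hZ.trans hh2).add (isBigO_refl (fun _ => (1 : ℝ)) l)
  have hbalance : (fun i => Δ i * (K i + U i * d i)) =O[l] fun i => h i ^ 2 := by
    simpa only [pow_two] using hΔ.mul hbal
  have hsquare : (fun i => Δ i ^ 2 * (K i * d i)) =O[l] fun i => h i ^ 2 := by
    simpa only [mul_one] using (hΔ.pow 2).mul (hone hK hd)
  have hXYZ : (fun i => X i * Y i * Z i - U i) =O[l] fun i => h i ^ 2 := by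
    refine (((((hone hX1 (hone hY1 hZ)).add (hone hX1 hY)).add (hone hΔd hX)).sub
      hbalance).add hsquare).congr_left fun i => ?_
    ring
  exact ((hone hX1 (hone hY1 (hone hZ1 hW))).add (hXYZ.mul hV)).congr_left fun i => by ring

end Asymptotics

/-- One time step on the `j`-th cell: the data of the step, together with the bounds on them under
which all estimates below are uniform. -/
structure CellStep (S : Set (Plane × ℝ)) (A : Plane × ℝ → Plane) (C c e : ℝ) where
  J : ℕ
  M : TriMesh J
  j : Fin J
  s : ℝ
  t : ℝ
  Φ : Plane → Plane
  ρ : Fin 7 → Plane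
  cell_subset : M.cell j ×ˢ {t} ⊆ S
  upstream_subset : upstream M Φ j ×ˢ {s} ⊆ S
  s_le : s ≤ t
  sub_le : t - s ≤ c * M.size
  size_le : M.size ≤ 1
  two_mul_le : 2 * ((t - s) * C) ≤ 1
  traced : Traced M Φ j (stepBase A (M.vert j 0, t) (t - s))
    ((stepLin A (M.vert j 0, t) (t - s)).comp (M.cellLin j)) ρ (e * M.size ^ 2)

/-- A cell step with a test function, its least-squares fit, and a reference point. Estimates that
are uniform in all these are `O`-relations with respect to the filter `⊤` on samples. -/
structure Sample (S : Set (Plane × ℝ)) (A : Plane × ℝ → Plane) (C c e : ℝ) extends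
    CellStep S A C c e where
  Ψ : Poly 2
  ψ : Poly 2
  fit : IsLeastSquaresFit M Φ j Ψ ψ
  ξ : Plane
  mem : ξ ∈ refTri

namespace CellStep

variable {S : Set (Plane × ℝ)} {A : Plane × ℝ → Plane} {u : Plane × ℝ → ℝ} {C c e : ℝ}
  (P : CellStep S A C c e)

/-- The mesh size. -/
def size : ℝ := P.M.size

/-- The first vertex of the cell at the arrival time, where all expansions are based. -/
def base : Plane × ℝ := (P.M.vert P.j 0, P.t)

/-- The length of the time step. -/
def lag : ℝ := P.t - P.s

/-- The linear part of the affine map from the reference triangle onto the cell. -/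
def lin : Plane →L[ℝ] Plane := P.M.cellLin P.j

/-- The affine map from the reference triangle onto the cell. -/
def arrival (ξ : Plane) : Plane := P.base.1 + P.lin ξ

/-- The map from the reference triangle onto the upstream element. -/
def departure (ξ : Plane) : Plane :=
  stepBase A P.base P.lag + stepLin A P.base P.lag (P.lin (perturb P.ρ ξ))

lemma size_nonneg : 0 ≤ P.size := P.M.size_nonneg

lemma lag_nonneg : 0 ≤ P.lag := sub_nonneg.2 P.s_le

lemma base_mem : P.base ∈ S := P.cell_subset ⟨P.M.vert_mem_cell P.j 0, rfl⟩

lemma arrival_mem_cell {ξ : Plane} (hξ : ξ ∈ refTri) : P.arrival ξ ∈ P.M.cell P.j :=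
  P.M.vert_add_cellLin_mem_cell P.j hξ

lemma arrival_mem {ξ : Plane} (hξ : ξ ∈ refTri) : (P.arrival ξ, P.t) ∈ S :=
  P.cell_subset ⟨P.arrival_mem_cell hξ, rfl⟩

lemma departure_mem {ξ : Plane} (hξ : ξ ∈ refTri) : (P.departure ξ, P.s) ∈ S :=
  P.upstream_subset ⟨P.traced.upstream_eq ▸ mem_image_of_mem _ hξ, rfl⟩

lemma norm_lag_smul_le (hA : TaylorBoundedOn A S C) :
    2 * ‖P.lag • spaceDeriv A P.base‖ ≤ 1 :=
  hA.two_mul_norm_smul_spaceDeriv_le P.base_mem P.lag_nonneg P.two_mul_le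

lemma continuousOn_departure (hu : ContinuousOn u S) :
    ContinuousOn (fun ξ => u (P.departure ξ, P.s)) refTri :=
  hu.comp (f := fun ξ => (P.departure ξ, P.s)) (by unfold departure; fun_prop)
    fun _ => P.departure_mem

lemma continuousOn_arrival (hu : ContinuousOn u S) :
    ContinuousOn (fun ξ => u (P.arrival ξ, P.t)) refTri :=
  hu.comp (f := fun ξ => (P.arrival ξ, P.t)) (by unfold arrival; fun_prop) fun _ => P.arrival_mem

end CellStep

namespace Sample

variable {S : Set (Plane × ℝ)} {A : Plane × ℝ → Plane} {u : Plane × ℝ → ℝ} {C c e : ℝ}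

/-- The test function in reference coordinates. -/
def test (P : Sample S A C c e) : Poly 2 := pullback P.base.1 P.lin P.Ψ

/-- The fitted test function in reference coordinates. -/
def fitted (P : Sample S A C c e) : Poly 2 :=
  pullback (stepBase A P.base P.lag) ((stepLin A P.base P.lag).comp P.lin) P.ψ

lemma isBigO_size_one :
    (fun P : Sample S A C c e => P.size) =O[⊤] fun _ => (1 : ℝ) :=
  isBigO_one_of_norm_le (k := 1) fun P => by
    rw [Real.norm_of_nonneg P.size_nonneg]
    exact P.size_le

lemma isBigO_lag : (fun P : Sample S A C c e => P.lag) =O[⊤] fun P => P.size :=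
  isBigO_of_norm_le_mul (k := c) fun P => by
    rw [Real.norm_of_nonneg P.lag_nonneg]
    exact P.sub_le

lemma isBigO_lin :
    (fun P : Sample S A C c e => P.lin) =O[⊤] fun P => P.size :=
  isBigO_of_norm_le_mul (k := 2) fun P => ContinuousLinearMap.opNorm_le_bound _
    (mul_nonneg two_pos.le P.size_nonneg) (P.M.norm_cellLin_apply_le P.j)

lemma isBigO_perturb_sub :
    (fun P : Sample S A C c e => perturb P.ρ P.ξ - P.ξ) =O[⊤] fun P => P.size ^ 2 :=
  isBigO_of_norm_le_mul (k := lebesgueConst * e) fun P => by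
    rw [mul_assoc]
    exact norm_perturb_sub_le P.traced.norm_le (refTri_subset_closedBall P.mem)

lemma isBigO_perturb :
    (fun P : Sample S A C c e => perturb P.ρ P.ξ) =O[⊤] fun _ => (1 : ℝ) :=
  isBigO_one_of_norm_le (k := 2) fun P =>
    mem_closedBall_zero_iff.1 (P.traced.perturb_mem_closedBall P.mem)

lemma isBigO_arrival_sub :
    (fun P : Sample S A C c e => P.arrival P.ξ - P.base.1) =O[⊤] fun P => P.size :=
  isBigO_of_norm_le_mul (k := 1) fun P => by
    rw [one_mul]
    exact TriMesh.norm_sub_le_size (P.arrival_mem_cell P.mem) (P.M.vert_mem_cell P.j 0)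

lemma isBigO_arrival_sub_base :
    (fun P : Sample S A C c e => (P.arrival P.ξ, P.t) - P.base) =O[⊤] fun P => P.size :=
  (isBigO_arrival_sub.prod_left (isBigO_zero _ ⊤ (E' := ℝ))).congr_left fun P => by
    ext1 <;> simp [CellStep.base]

section Velocity

variable (hA : TaylorBoundedOn A S C) (hC : 1 ≤ C)
include hA

lemma isBigO_spaceDeriv :
    (fun P : Sample S A C c e => spaceDeriv A P.base) =O[⊤] fun _ => (1 : ℝ) :=
  isBigO_one_of_norm_le fun P =>
    (norm_spaceDeriv_le A P.base).trans (hA.norm_fderiv_le _ P.base_mem)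

lemma isBigO_trace : (fun P : Sample S A C c e =>
    LinearMap.trace ℝ Plane (spaceDeriv A P.base)) =O[⊤] fun _ => (1 : ℝ) :=
  (isBigO_of_norm_le_mul fun P => abs_trace_le (spaceDeriv A P.base)).trans
    (isBigO_spaceDeriv hA).norm_left

lemma isBigO_abs_det_stepLin_sub :
    (fun P : Sample S A C c e => |(stepLin A P.base P.lag).det|
      - (1 - P.lag * LinearMap.trace ℝ Plane (spaceDeriv A P.base))) =O[⊤]
      fun P => P.size ^ 2 := by
  refine (isBigO_of_norm_le_mul (k := 2)
    (g := fun P : Sample S A C c e => ‖P.lag • spaceDeriv A P.base‖ ^ 2) fun P => ?_).trans ?_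
  · have hdet := abs_abs_det_id_add_sub_le (P := -(P.lag • spaceDeriv A P.base))
      (by simpa only [norm_neg] using P.norm_lag_smul_le hA)
    simpa [← sub_eq_add_neg, stepLin] using hdet
  · simpa using ((isBigO_lag.smul (isBigO_spaceDeriv hA)).norm_left).pow 2

include hC

lemma isBigO_drift :
    (fun P : Sample S A C c e => (A P.base, (1 : ℝ))) =O[⊤] fun _ => (1 : ℝ) :=
  isBigO_one_of_norm_le fun P => hA.norm_prodMk_one_le hC P.base_mem

lemma isBigO_departure_sub_add :
    (fun P : Sample S A C c e => P.departure P.ξ - P.arrival P.ξ + P.lag • A P.base) =O[⊤]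
      fun P => P.size ^ 2 := by
  have haccel : (fun P : Sample S A C c e => accel A P.base) =O[⊤] fun _ => (1 : ℝ) :=
    isBigO_one_of_norm_le fun P => hA.norm_accel_le hC P.base_mem
  have hcurv : (fun P : Sample S A C c e => (P.lag ^ 2 / 2) • accel A P.base) =O[⊤]
      fun P => P.size ^ 2 := by
    simpa [div_eq_inv_mul] using ((isBigO_lag.pow 2).const_mul_left 2⁻¹).smul haccel
  have hnode : (fun P : Sample S A C c e => P.lin (perturb P.ρ P.ξ - P.ξ)) =O[⊤]
      fun P => P.size ^ 2 := by
    simpa using isBigO_apply (isBigO_lin.trans isBigO_size_one) isBigO_perturb_sub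
  have hdefo : (fun P : Sample S A C c e =>
      P.lag • spaceDeriv A P.base (P.lin (perturb P.ρ P.ξ))) =O[⊤] fun P => P.size ^ 2 := by
    simpa [pow_two] using isBigO_lag.smul
      (isBigO_apply (isBigO_spaceDeriv hA) (isBigO_apply isBigO_lin isBigO_perturb))
  refine ((hcurv.add hnode).sub hdefo).congr_left fun P => ?_
  simp only [CellStep.departure, CellStep.arrival, stepBase, stepLin, sub_apply, smul_apply,
    ContinuousLinearMap.id_apply, map_sub]
  abel

end Velocity

section Solution

variable (hD : TransportBounds S A u C)
include hD

lemma isBigO_departure_sub_arrival :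
    (fun P : Sample S A C c e => (P.departure P.ξ, P.s) - (P.arrival P.ξ, P.t)) =O[⊤]
      fun P => P.size := by
  have hsq : (fun P : Sample S A C c e => P.size ^ 2) =O[⊤] fun P => P.size := by
    simpa only [pow_two, mul_one] using
      (isBigO_refl (fun P : Sample S A C c e => P.size) ⊤).mul isBigO_size_one
  have hdrift : (fun P : Sample S A C c e => P.lag • (A P.base, (1 : ℝ))) =O[⊤]
      fun P => P.size := by
    simpa using isBigO_lag.smul (isBigO_drift hD.velocity hD.one_le)
  refine ((((isBigO_departure_sub_add hD.velocity hD.one_le).trans hsq).prod_left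
    (isBigO_zero (fun P : Sample S A C c e => P.size) ⊤ (E' := ℝ))).sub hdrift).congr_left
    fun P => ?_
  ext1 <;> simp [CellStep.lag]

lemma isBigO_fderiv_solution : (fun P : Sample S A C c e => fderiv ℝ u (P.arrival P.ξ, P.t)) =O[⊤]
    fun _ => (1 : ℝ) :=
  isBigO_one_of_norm_le fun P => hD.solution.norm_fderiv_le _ (P.arrival_mem P.mem)

lemma isBigO_fderiv_solution_sub :
    (fun P : Sample S A C c e => fderiv ℝ u (P.arrival P.ξ, P.t) - fderiv ℝ u P.base) =O[⊤]
      fun P => P.size :=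
  (isBigO_of_norm_le_mul fun P => hD.solution.norm_fderiv_sub_le _ P.base_mem _
    (P.arrival_mem P.mem)).trans isBigO_arrival_sub_base.norm_left

lemma isBigO_solution_departure :
    (fun P : Sample S A C c e => u (P.departure P.ξ, P.s)
      - (u (P.arrival P.ξ, P.t) - P.lag * fderiv ℝ u P.base (A P.base, 1))) =O[⊤]
      fun P => P.size ^ 2 := by
  have hdrift := isBigO_drift (c := c) (e := e) hD.velocity hD.one_le
  have hrem : (fun P : Sample S A C c e => u (P.departure P.ξ, P.s) - u (P.arrival P.ξ, P.t)
      - fderiv ℝ u (P.arrival P.ξ, P.t)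
        ((P.departure P.ξ, P.s) - (P.arrival P.ξ, P.t))) =O[⊤] fun P => P.size ^ 2 :=
    (isBigO_of_norm_le_mul fun P => hD.solution.norm_remainder_le _ (P.arrival_mem P.mem) _
      (P.departure_mem P.mem)).trans ((isBigO_departure_sub_arrival hD).norm_left.pow 2)
  have hdrift_error : (fun P : Sample S A C c e => fderiv ℝ u (P.arrival P.ξ, P.t)
      (P.departure P.ξ - P.arrival P.ξ + P.lag • A P.base, 0)) =O[⊤] fun P => P.size ^ 2 := by
    simpa using isBigO_apply (isBigO_fderiv_solution hD)
      ((isBigO_departure_sub_add hD.velocity hD.one_le).prod_left (isBigO_zero _ ⊤ (E' := ℝ)))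
  have hbase : (fun P : Sample S A C c e =>
      P.lag * (fderiv ℝ u (P.arrival P.ξ, P.t) - fderiv ℝ u P.base) (A P.base, 1)) =O[⊤]
      fun P => P.size ^ 2 := by
    simpa [pow_two] using
      isBigO_lag.mul (isBigO_apply (isBigO_fderiv_solution_sub hD) hdrift)
  refine ((hrem.add hdrift_error).sub hbase).congr_left fun P => ?_
  have hsplit : (P.departure P.ξ, P.s) - (P.arrival P.ξ, P.t)
      = (P.departure P.ξ - P.arrival P.ξ + P.lag • A P.base, 0) - P.lag • (A P.base, (1 : ℝ)) := by
    ext1 <;> simp [CellStep.lag]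
  rw [hsplit, map_sub, map_smul, sub_apply, smul_eq_mul]
  ring

lemma isBigO_solution :
    (fun P : Sample S A C c e => u (P.arrival P.ξ, P.t)) =O[⊤] fun _ => (1 : ℝ) :=
  isBigO_one_of_norm_le fun P => hD.solution.norm_le _ (P.arrival_mem P.mem)

lemma isBigO_fderiv_drift :
    (fun P : Sample S A C c e => fderiv ℝ u P.base (A P.base, 1)) =O[⊤] fun _ => (1 : ℝ) := by
  simpa using isBigO_apply
    (isBigO_one_of_norm_le fun P : Sample S A C c e => hD.solution.norm_fderiv_le _ P.base_mem)
    (isBigO_drift hD.velocity hD.one_le)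

/-- The transport equation holds exactly at the base point, so only `u` has to be moved. -/
lemma isBigO_transport :
    (fun P : Sample S A C c e => fderiv ℝ u P.base (A P.base, 1)
      + u (P.arrival P.ξ, P.t) * LinearMap.trace ℝ Plane (spaceDeriv A P.base)) =O[⊤]
      fun P => P.size := by
  have hmove : (fun P : Sample S A C c e => u (P.arrival P.ξ, P.t) - u P.base) =O[⊤]
      fun P => P.size :=
    (isBigO_of_norm_le_mul fun P => hD.solution.norm_sub_le _ P.base_mem _
      (P.arrival_mem P.mem)).trans isBigO_arrival_sub_base.norm_left
  have hprod := hmove.mul (isBigO_trace hD.velocity)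
  simp only [mul_one] at hprod
  refine hprod.congr_left fun P => ?_
  linear_combination -(hD.transport _ P.base_mem)

end Solution

lemma isBigO_abs_det_perturb_sub : (fun P : Sample S A C c e =>
    |(ContinuousLinearMap.id ℝ Plane + perturbDeriv P.ρ P.ξ).det| - 1) =O[⊤]
      fun P => P.size ^ 2 :=
  isBigO_of_norm_le_mul (k := 3 * (lebesgueConst * e)) fun P => by
    have hsmall : ‖perturbDeriv P.ρ P.ξ‖ ≤ lebesgueConst * (e * P.size ^ 2) :=
      norm_perturbDeriv_le P.traced.norm_le (refTri_subset_closedBall P.mem)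
    refine (abs_abs_det_id_add_sub_one_le ?_).trans ?_
    · exact (mul_le_mul_of_nonneg_left hsmall two_pos.le).trans P.traced.eps_le
    · linarith

lemma isBigO_test :
    (fun P : Sample S A C c e => pval P.test P.ξ) =O[⊤] fun P => nodalNorm P.test :=
  isBigO_of_norm_le_mul fun P => abs_pval_le P.test (refTri_subset_closedBall P.mem)

lemma isBigO_fitted_sub :
    (fun P : Sample S A C c e => pval P.fitted (perturb P.ρ P.ξ) - pval P.test P.ξ) =O[⊤]
      fun P => P.size ^ 2 * nodalNorm P.test := by
  have hfit : (fun P : Sample S A C c e => pval (P.fitted - P.test) (perturb P.ρ P.ξ)) =O[⊤]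
      fun P => P.size ^ 2 * nodalNorm P.test :=
    isBigO_of_norm_le_mul (k := lebesgueConst * (2 * (√7 + 1) * lebesgueConst * e)) fun P =>
      (abs_pval_le _ (P.traced.perturb_mem_closedBall P.mem)).trans <|
        (mul_le_mul_of_nonneg_left (P.traced.nodalNorm_fit_sub_le P.fit)
          lebesgueConst_pos.le).trans_eq <| by
            simp only [test, CellStep.base, CellStep.lin, CellStep.size]
            ring
  have hmove : (fun P : Sample S A C c e => pval P.test (perturb P.ρ P.ξ) - pval P.test P.ξ) =O[⊤]
      fun P => P.size ^ 2 * nodalNorm P.test := by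
    refine (isBigO_of_norm_le_mul (k := lebesgueConst)
      (g := fun P : Sample S A C c e => ‖perturb P.ρ P.ξ - P.ξ‖ * nodalNorm P.test)
      fun P => ?_).trans (isBigO_perturb_sub.norm_left.mul (isBigO_refl _ _))
    refine (abs_pval_sub_le P.test (refTri_subset_closedBall P.mem)
      (P.traced.perturb_mem_closedBall P.mem)).trans_eq ?_
    ring
  exact (hfit.add hmove).congr_left fun P => by simp

lemma isBigO_integrand_sub (hD : TransportBounds S A u C) :
    (fun P : Sample S A C c e => u (P.departure P.ξ, P.s) * |(stepLin A P.base P.lag).det|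
        * |(ContinuousLinearMap.id ℝ Plane + perturbDeriv P.ρ P.ξ).det|
        * pval P.fitted (perturb P.ρ P.ξ)
      - u (P.arrival P.ξ, P.t) * pval P.test P.ξ) =O[⊤]
      fun P => P.size ^ 2 * nodalNorm P.test :=
  isBigO_product_sub isBigO_size_one isBigO_lag (isBigO_solution hD) (isBigO_fderiv_drift hD)
    (isBigO_trace hD.velocity) (isBigO_transport hD) (isBigO_solution_departure hD)
    (isBigO_abs_det_stepLin_sub hD.velocity) isBigO_abs_det_perturb_sub isBigO_fitted_sub
    isBigO_test

end Sample

namespace CellStep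

variable {S : Set (Plane × ℝ)} {A : Plane × ℝ → Plane} {u : Plane × ℝ → ℝ} {C c e : ℝ}

lemma setIntegral_upstream_sub (hu : ContinuousOn u S) (P : CellStep S A C c e) (Ψ ψ : Poly 2) :
    (∫ x in upstream P.M P.Φ P.j, u (x, P.s) * pval ψ x)
        - ∫ x in P.M.cell P.j, u (x, P.t) * pval Ψ x
      = |P.lin.det| * ∫ ξ in refTri, (u (P.departure ξ, P.s) * |(stepLin A P.base P.lag).det|
          * |(ContinuousLinearMap.id ℝ Plane + perturbDeriv P.ρ ξ).det| * pval ψ (P.departure ξ)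
        - u (P.arrival ξ, P.t) * pval Ψ (P.arrival ξ)) := by
  have hdet : ((stepLin A P.base P.lag).comp P.lin).det
      = (stepLin A P.base P.lag).det * P.lin.det :=
    LinearMap.det_comp _ _
  have hjac : Continuous fun ξ => |(ContinuousLinearMap.id ℝ Plane + perturbDeriv P.ρ ξ).det| :=
    (ContinuousLinearMap.continuous_det.comp (by fun_prop)).abs
  have hψ : Continuous fun ξ => pval ψ (P.departure ξ) := by unfold departure; fun_prop
  have hΨ : Continuous fun ξ => pval Ψ (P.arrival ξ) := by unfold arrival; fun_prop
  have hint : IntegrableOn (fun ξ => u (P.departure ξ, P.s) * |(stepLin A P.base P.lag).det|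
      * |(ContinuousLinearMap.id ℝ Plane + perturbDeriv P.ρ ξ).det|
      * pval ψ (P.departure ξ)) refTri :=
    ((((P.continuousOn_departure hu).mul continuousOn_const).mul hjac.continuousOn).mul
      hψ.continuousOn).integrableOn_compact isCompact_refTri
  have hint' : IntegrableOn (fun ξ => u (P.arrival ξ, P.t) * pval Ψ (P.arrival ξ)) refTri :=
    ((P.continuousOn_arrival hu).mul hΨ.continuousOn).integrableOn_compact isCompact_refTri
  have hupstream : ∫ x in upstream P.M P.Φ P.j, u (x, P.s) * pval ψ x
      = |P.lin.det| * ∫ ξ in refTri, u (P.departure ξ, P.s) * |(stepLin A P.base P.lag).det|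
        * |(ContinuousLinearMap.id ℝ Plane + perturbDeriv P.ρ ξ).det|
        * pval ψ (P.departure ξ) := by
    refine (P.traced.setIntegral_upstream _).trans ?_
    change |((stepLin A P.base P.lag).comp P.lin).det| * _ = _
    rw [hdet, abs_mul, mul_comm |_|, mul_assoc, ← integral_const_mul]
    congr 2 with ξ
    simp only [departure, base, lag, lin, ContinuousLinearMap.comp_apply]
    ring
  rw [hupstream, P.M.setIntegral_cell P.j, integral_sub hint hint', mul_sub]
  rfl

end CellStep

lemma exists_consistency {S : Set (Plane × ℝ)} {A : Plane × ℝ → Plane} {u : Plane × ℝ → ℝ} {C : ℝ}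
    (hD : TransportBounds S A u C) (c e : ℝ) :
    ∃ K, ∀ (P : CellStep S A C c e) (Ψ ψ : Poly 2), IsLeastSquaresFit P.M P.Φ P.j Ψ ψ →
      |(∫ x in upstream P.M P.Φ P.j, u (x, P.s) * pval ψ x)
          - ∫ x in P.M.cell P.j, u (x, P.t) * pval Ψ x|
        ≤ K * (P.size ^ 2 * |P.lin.det| * nodalNorm (pullback P.base.1 P.lin Ψ)) := by
  have hcont : ContinuousOn u S := fun p hp =>
    (hD.solution.differentiableAt p hp).continuousAt.continuousWithinAt
  obtain ⟨K, hK⟩ := isBigO_top.1 (Sample.isBigO_integrand_sub (c := c) (e := e) hD)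
  refine ⟨K * volume.real refTri, fun P Ψ ψ hfit => ?_⟩
  have hint : ‖∫ ξ in refTri, (u (P.departure ξ, P.s) * |(stepLin A P.base P.lag).det|
          * |(ContinuousLinearMap.id ℝ Plane + perturbDeriv P.ρ ξ).det| * pval ψ (P.departure ξ)
        - u (P.arrival ξ, P.t) * pval Ψ (P.arrival ξ))‖
      ≤ K * (P.size ^ 2 * nodalNorm (pullback P.base.1 P.lin Ψ)) * volume.real refTri :=
    norm_setIntegral_le_of_norm_le_const isCompact_refTri.measure_lt_top fun ξ hξ => by
      have hbound := hK ⟨P, Ψ, ψ, hfit, ξ, hξ⟩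
      rwa [Real.norm_of_nonneg (mul_nonneg (sq_nonneg _) (nodalNorm_nonneg _)),
        Sample.test, Sample.fitted, pval_pullback, pval_pullback] at hbound
  rw [P.setIntegral_upstream_sub hcont, abs_mul, abs_abs]
  refine (mul_le_mul_of_nonneg_left hint (abs_nonneg _)).trans_eq ?_
  ring

/-! ### The error inherited from the previous time level -/

lemma abs_setIntegral_mul_le_of_eLpNorm_le {α : Type*} [MeasurableSpace α] {μ : Measure α}
    {D : Set α} {f g : α → ℝ} {B b : ℝ} (hD : MeasurableSet D) (hμD : μ D ≠ ⊤)
    (hf : IntegrableOn f D μ) (hB : 0 ≤ B) (hfB : eLpNorm f 2 (μ.restrict D) ≤ ENNReal.ofReal B)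
    (hb : 0 ≤ b) (hg : ∀ x ∈ D, |g x| ≤ b) :
    |∫ x in D, f x * g x ∂μ| ≤ b * (B * √(μ.real D)) := by
  have hone : eLpNorm f 1 (μ.restrict D) ≤ ENNReal.ofReal (B * √(μ.real D)) := by
    refine (eLpNorm_le_eLpNorm_mul_rpow_measure_univ one_le_two hf.aestronglyMeasurable).trans ?_
    rw [ENNReal.ofReal_mul hB]
    refine mul_le_mul' hfB (le_of_eq ?_)
    rw [Measure.restrict_apply_univ, Real.sqrt_eq_rpow, ← ENNReal.ofReal_rpow_of_nonneg
      measureReal_nonneg (by norm_num), ofReal_measureReal hμD]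
    norm_num
  have habs : ∫ x in D, ‖f x‖ ∂μ ≤ B * √(μ.real D) := by
    rw [integral_norm_eq_lintegral_enorm hf.aestronglyMeasurable, ← eLpNorm_one_eq_lintegral_enorm]
    exact ENNReal.toReal_le_of_le_ofReal (by positivity) hone
  calc |∫ x in D, f x * g x ∂μ| ≤ ∫ x in D, b * ‖f x‖ ∂μ := by
        refine norm_integral_le_of_norm_le (f := fun x => f x * g x) (hf.norm.const_mul b)
          (ae_restrict_of_forall_mem hD fun x hx => ?_)
        rw [norm_mul, mul_comm]
        exact mul_le_mul_of_nonneg_right (hg x hx) (norm_nonneg _)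
    _ = b * ∫ x in D, ‖f x‖ ∂μ := integral_const_mul _ _
    _ ≤ b * (B * √(μ.real D)) := mul_le_mul_of_nonneg_left habs hb

namespace TriMesh

variable {J : ℕ} (M : TriMesh J)

lemma sqrt_volume_real_cell_le (j : Fin J) : √(volume.real (M.cell j)) ≤ √Real.pi * M.size := by
  refine (Real.sqrt_le_sqrt (M.volume_real_cell_le j)).trans_eq ?_
  rw [Real.sqrt_mul Real.pi_pos.le, Real.sqrt_sq M.size_nonneg]

variable {M} {D : Set Plane} {f : Plane → ℝ}

lemma remapIntegral_sub (hD : IsCompact D) (hsub : D ⊆ M.region) (hf : ContinuousOn f D)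
    (v : M.DGSpace 2) (ψ : Poly 2) :
    remapIntegral M D v ψ - ∫ x in D, f x * pval ψ x
      = ∑ l, ∫ x in D ∩ M.cell l, (pval (v l) x - f x) * pval ψ x := by
  have hint : IntegrableOn (fun x => f x * pval ψ x) D :=
    (hf.mul (continuous_pval ψ).continuousOn).integrableOn_compact hD
  rw [M.setIntegral_eq_sum hD.measurableSet hsub hint, remapIntegral, ← Finset.sum_sub_distrib]
  refine Finset.sum_congr rfl fun l _ => ?_
  simp only [sub_mul]
  exact (integral_sub (integrableOn_pval_mul_pval (hD.isBounded.subset inter_subset_left) _ _)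
    (hint.mono_set inter_subset_left)).symm

lemma abs_setIntegral_inter_cell_le (hD : IsCompact D) (hf : ContinuousOn f D) {C₀ b : ℝ}
    {l : Fin J} {p ψ : Poly 2} (hp : cellError M l p f ≤ ENNReal.ofReal (C₀ * M.size ^ 3))
    (hb : 0 ≤ b) (hψ : ∀ x ∈ D, |pval ψ x| ≤ b) :
    |∫ x in D ∩ M.cell l, (pval p x - f x) * pval ψ x|
      ≤ b * (|C₀| * √Real.pi * M.size ^ 4) := by
  have := M.size_nonneg
  have hcompact : IsCompact (D ∩ M.cell l) := hD.inter (M.isCompact_cell l)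
  have hint : IntegrableOn (fun x => pval p x - f x) (D ∩ M.cell l) :=
    ((continuous_pval p).continuousOn.sub (hf.mono inter_subset_left)).integrableOn_compact hcompact
  have hnorm : eLpNorm (fun x => pval p x - f x) 2 (volume.restrict (D ∩ M.cell l))
      ≤ ENNReal.ofReal (|C₀| * M.size ^ 3) :=
    calc _ ≤ cellError M l p f :=
          eLpNorm_mono_measure _ (Measure.restrict_mono inter_subset_right le_rfl)
      _ ≤ ENNReal.ofReal (C₀ * M.size ^ 3) := hp
      _ ≤ ENNReal.ofReal (|C₀| * M.size ^ 3) := by gcongr; exact le_abs_self C₀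
  have hvol : √(volume.real (D ∩ M.cell l)) ≤ √Real.pi * M.size :=
    (Real.sqrt_le_sqrt (measureReal_mono inter_subset_right
      (M.isCompact_cell l).measure_lt_top.ne)).trans (M.sqrt_volume_real_cell_le l)
  calc _ ≤ b * (|C₀| * M.size ^ 3 * √(volume.real (D ∩ M.cell l))) :=
        abs_setIntegral_mul_le_of_eLpNorm_le hcompact.measurableSet hcompact.measure_lt_top.ne hint
          (by positivity) hnorm hb fun x hx => hψ x hx.1
    _ ≤ b * (|C₀| * M.size ^ 3 * (√Real.pi * M.size)) := by gcongr
    _ = b * (|C₀| * √Real.pi * M.size ^ 4) := by ring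

lemma IsQuasiUniform.abs_remapIntegral_sub_le {σ : ℝ} (hσ : 0 < σ) (hM : M.IsQuasiUniform σ)
    (hD : IsCompact D) (hsub : D ⊆ M.region) {x₀ : Plane} {r : ℝ} (hr : 0 ≤ r)
    (hball : D ⊆ Metric.closedBall x₀ (r * M.size)) (hf : ContinuousOn f D) {C₀ b : ℝ}
    {v : M.DGSpace 2} (hv : ∀ l, cellError M l (v l) f ≤ ENNReal.ofReal (C₀ * M.size ^ 3))
    {ψ : Poly 2} (hb : 0 ≤ b) (hψ : ∀ x ∈ D, |pval ψ x| ≤ b) :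
    |remapIntegral M D v ψ - ∫ x in D, f x * pval ψ x|
      ≤ ((r + 1) / σ) ^ 2 * (b * (|C₀| * √Real.pi * M.size ^ 4)) := by
  classical
  set met := Finset.univ.filter fun l => (D ∩ M.cell l).Nonempty with hmet
  have hzero : ∀ l ∉ met, ∫ x in D ∩ M.cell l, (pval (v l) x - f x) * pval ψ x = 0 := fun l hl => by
    have hempty : D ∩ M.cell l = ∅ := by
      simpa only [hmet, Finset.mem_filter_univ, not_nonempty_iff_eq_empty] using hl
    rw [hempty, setIntegral_empty]
  have hcard : (met.card : ℝ) ≤ ((r + 1) / σ) ^ 2 := hM.card_le hσ hr x₀ fun l hl =>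
    (Finset.mem_filter_univ l).1 hl |>.mono fun x hx => ⟨hx.2, hball hx.1⟩
  have := M.size_nonneg
  rw [remapIntegral_sub hD hsub hf,
    ← Finset.sum_subset met.subset_univ fun l _ hl => hzero l hl]
  calc _ ≤ ∑ l ∈ met, |∫ x in D ∩ M.cell l, (pval (v l) x - f x) * pval ψ x| :=
        Finset.abs_sum_le_sum_abs _ _
    _ ≤ met.card • (b * (|C₀| * √Real.pi * M.size ^ 4)) :=
        Finset.sum_le_card_nsmul _ _ _ fun l _ => abs_setIntegral_inter_cell_le hD hf (hv l) hb hψ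
    _ ≤ ((r + 1) / σ) ^ 2 * (b * (|C₀| * √Real.pi * M.size ^ 4)) := by
        rw [nsmul_eq_mul]
        gcongr

lemma IsQuasiUniform.sq_size_le {σ : ℝ} (hσ : 0 < σ) (hM : M.IsQuasiUniform σ) (j : Fin J) :
    M.size ^ 2 ≤ |(M.cellLin j).det| * (volume.real refTri / (Real.pi * σ ^ 2)) := by
  have hvol := hM.le_volume_real_cell j hσ.le
  rw [M.volume_real_cell] at hvol
  rw [← mul_div_assoc, le_div_iff₀ (by positivity)]
  linarith

lemma cellError_le {j : Fin J} {p : Poly 2} {B : ℝ} (hB : 0 ≤ B)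
    (h : ∀ x ∈ M.cell j, |pval p x - f x| ≤ B) :
    cellError M j p f ≤ ENNReal.ofReal (B * (√Real.pi * M.size)) := by
  refine (eLpNorm_le_of_ae_bound (ae_restrict_of_forall_mem (M.measurableSet_cell j) h)).trans ?_
  rw [mul_comm, ENNReal.ofReal_mul hB]
  refine mul_le_mul_right ?_ _
  rw [Measure.restrict_apply_univ, ← ofReal_measureReal (M.isCompact_cell j).measure_lt_top.ne,
    ENNReal.ofReal_rpow_of_nonneg measureReal_nonneg (by norm_num)]
  refine ENNReal.ofReal_le_ofReal (le_trans (le_of_eq ?_) (M.sqrt_volume_real_cell_le j))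
  rw [Real.sqrt_eq_rpow]
  norm_num

end TriMesh

lemma norm_stepLin_le {A : Plane × ℝ → Plane} {p : Plane × ℝ} {Δ : ℝ}
    (hΔ : 2 * ‖Δ • spaceDeriv A p‖ ≤ 1) (y : Plane) : ‖stepLin A p Δ y‖ ≤ 2 * ‖y‖ := by
  have hsmall : ‖(Δ • spaceDeriv A p) y‖ ≤ 1 * ‖y‖ :=
    (Δ • spaceDeriv A p).le_of_opNorm_le (by linarith [norm_nonneg (Δ • spaceDeriv A p)]) y
  have hsub : ‖stepLin A p Δ y‖ ≤ ‖y‖ + ‖(Δ • spaceDeriv A p) y‖ := norm_sub_le _ _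
  linarith

namespace CellStep

variable {S : Set (Plane × ℝ)} {A : Plane × ℝ → Plane} {u : Plane × ℝ → ℝ} {C c e : ℝ}
  (P : CellStep S A C c e)

lemma upstream_subset_closedBall (hA : TaylorBoundedOn A S C) :
    upstream P.M P.Φ P.j ⊆ Metric.closedBall (stepBase A P.base P.lag) (8 * P.M.size) := by
  rw [P.traced.upstream_eq]
  rintro _ ⟨ξ, hξ, rfl⟩
  rw [mem_closedBall_iff_norm]
  have hstep := norm_stepLin_le (P.norm_lag_smul_le hA) (P.lin (perturb P.ρ ξ))
  have hlin : ‖P.lin (perturb P.ρ ξ)‖ ≤ 2 * P.M.size * 2 :=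
    (P.M.norm_cellLin_apply_le P.j _).trans (mul_le_mul_of_nonneg_left
      (mem_closedBall_zero_iff.1 (P.traced.perturb_mem_closedBall hξ))
      (mul_nonneg zero_le_two P.M.size_nonneg))
  calc _ = ‖stepLin A P.base P.lag (P.lin (perturb P.ρ ξ))‖ := by
        congr 1; exact add_sub_cancel_left _ _
    _ ≤ 8 * P.M.size := by linarith

lemma abs_remapIntegral_sub_le (hA : TaylorBoundedOn A S C) (hu : ContinuousOn u S) {σ C₀ : ℝ}
    (hσ : 0 < σ) (hM : P.M.IsQuasiUniform σ) (hsub : upstream P.M P.Φ P.j ⊆ P.M.region)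
    {v : P.M.DGSpace 2}
    (hv : ∀ l, cellError P.M l (v l) (fun x => u (x, P.s)) ≤ ENNReal.ofReal (C₀ * P.M.size ^ 3))
    {Ψ ψ : Poly 2} (hfit : IsLeastSquaresFit P.M P.Φ P.j Ψ ψ) :
    |remapIntegral P.M (upstream P.M P.Φ P.j) v ψ
        - ∫ x in upstream P.M P.Φ P.j, u (x, P.s) * pval ψ x|
      ≤ ((8 + 1) / σ) ^ 2 * ((√7 + 2) * lebesgueConst * (|C₀| * √Real.pi))
        * (volume.real refTri / (Real.pi * σ ^ 2))
        * (P.size ^ 2 * |P.lin.det| * nodalNorm (pullback P.base.1 P.lin Ψ)) := by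
  have hm := nodalNorm_nonneg (pullback P.base.1 P.lin Ψ)
  have hlebesgue := lebesgueConst_pos
  have hcont : ContinuousOn (fun x => u (x, P.s)) (upstream P.M P.Φ P.j) :=
    hu.comp (f := fun x : Plane => (x, P.s)) (by fun_prop) fun x hx => P.upstream_subset ⟨hx, rfl⟩
  have hremap := hM.abs_remapIntegral_sub_le hσ P.traced.isCompact_upstream hsub (by norm_num)
    (P.upstream_subset_closedBall hA) hcont hv
    (b := (√7 + 2) * lebesgueConst * nodalNorm (pullback P.base.1 P.lin Ψ)) (by positivity)
    fun x hx => P.traced.abs_fit_le hfit hx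
  have hsize : P.M.size ^ 2 ≤ |P.lin.det| * (volume.real refTri / (Real.pi * σ ^ 2)) :=
    hM.sq_size_le hσ P.j
  refine hremap.trans ?_
  calc _ = ((8 + 1) / σ) ^ 2 * ((√7 + 2) * lebesgueConst * (|C₀| * √Real.pi)) * P.M.size ^ 2
        * nodalNorm (pullback P.base.1 P.lin Ψ) * P.M.size ^ 2 := by ring
    _ ≤ ((8 + 1) / σ) ^ 2 * ((√7 + 2) * lebesgueConst * (|C₀| * √Real.pi)) * P.M.size ^ 2
        * nodalNorm (pullback P.base.1 P.lin Ψ)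
        * (|P.lin.det| * (volume.real refTri / (Real.pi * σ ^ 2))) := by gcongr
    _ = _ := by rw [size]; ring

end CellStep

/-! ### The error estimate -/

section Moments

variable {J : ℕ} {M : TriMesh J} {j : Fin J}

lemma TriMesh.abs_det_cellLin_pos : 0 < |(M.cellLin j).det| :=
  abs_pos.2 fun h => (LinearMap.bot_lt_ker_of_det_eq_zero h).ne'
    (LinearMap.ker_eq_bot.2 (M.cellLin_injective j))

lemma abs_pval_le_nodalNorm_pullback (p : Poly 2) {x : Plane} (hx : x ∈ M.cell j) :
    |pval p x| ≤ lebesgueConst * nodalNorm (pullback (M.vert j 0) (M.cellLin j) p) := by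
  rw [M.cell_eq_image] at hx
  obtain ⟨ξ, hξ, rfl⟩ := hx
  rw [← pval_pullback]
  exact abs_pval_le _ (refTri_subset_closedBall hξ)

lemma TaylorBoundedOn.exists_abs_sub_pval_le {S : Set (Plane × ℝ)} {u : Plane × ℝ → ℝ} {C t : ℝ}
    (hu : TaylorBoundedOn u S C) (hcell : M.cell j ×ˢ {t} ⊆ S) :
    ∃ q : Poly 2, ∀ x ∈ M.cell j, |u (x, t) - pval q x| ≤ C * M.size ^ 2 := by
  have hvert := M.vert_mem_cell j 0
  have hbase : (M.vert j 0, t) ∈ S := hcell ⟨hvert, rfl⟩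
  have hC : 0 ≤ C := (norm_nonneg _).trans (hu.norm_le _ hbase)
  obtain ⟨q, hq⟩ := exists_pval_eq_affine one_le_two (u (M.vert j 0, t))
    ((fderiv ℝ u (M.vert j 0, t)).comp (ContinuousLinearMap.inl ℝ Plane ℝ)) (M.vert j 0)
  refine ⟨q, fun x hx => ?_⟩
  have hdiff : (x, t) - (M.vert j 0, t) = (x - M.vert j 0, 0) := by simp
  have hrem := hu.norm_remainder_le _ hbase (x, t) (hcell ⟨hx, rfl⟩)
  rw [hdiff, Prod.norm_mk, norm_zero, max_eq_left (norm_nonneg _), Real.norm_eq_abs] at hrem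
  rw [hq, ← sub_sub]
  refine hrem.trans ?_
  gcongr
  exact M.norm_sub_le_size hx hvert

variable {f : Plane → ℝ} {p q : Poly 2} {B E : ℝ}

lemma integral_pval_sub_mul_self_le (hf : ContinuousOn f (M.cell j))
    (hq : ∀ x ∈ M.cell j, |f x - pval q x| ≤ B)
    (hp : |(∫ x in M.cell j, pval p x * pval (p - q) x) - ∫ x in M.cell j, f x * pval (p - q) x|
      ≤ E) :
    ∫ x in M.cell j, pval (p - q) x * pval (p - q) x
      ≤ E + B * (lebesgueConst * nodalNorm (pullback (M.vert j 0) (M.cellLin j) (p - q)))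
        * (|(M.cellLin j).det| * volume.real refTri) := by
  have hcompact := M.isCompact_cell j
  have hpoly (r : Poly 2) := integrableOn_pval_mul_pval hcompact.isBounded r (p - q)
  have hfint : IntegrableOn (fun x => f x * pval (p - q) x) (M.cell j) :=
    (hf.mul (continuous_pval _).continuousOn).integrableOn_compact hcompact
  have hsplit : ∫ x in M.cell j, pval (p - q) x * pval (p - q) x
      = ((∫ x in M.cell j, pval p x * pval (p - q) x) - ∫ x in M.cell j, f x * pval (p - q) x)
        + ∫ x in M.cell j, (f x - pval q x) * pval (p - q) x := by
    simp only [sub_mul]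
    rw [integral_sub hfint (hpoly q), sub_add_sub_cancel, ← integral_sub (hpoly p) (hpoly q)]
    simp only [pval_sub, sub_mul]
  have happrox : |∫ x in M.cell j, (f x - pval q x) * pval (p - q) x|
      ≤ B * (lebesgueConst * nodalNorm (pullback (M.vert j 0) (M.cellLin j) (p - q)))
        * (|(M.cellLin j).det| * volume.real refTri) := by
    rw [← M.volume_real_cell, ← Real.norm_eq_abs]
    refine norm_setIntegral_le_of_norm_le_const hcompact.measure_lt_top fun x hx => ?_
    rw [norm_mul]
    exact mul_le_mul (hq x hx) (abs_pval_le_nodalNorm_pullback _ hx) (norm_nonneg _)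
      ((abs_nonneg _).trans (hq x hx))
  rw [hsplit]
  exact add_le_add ((le_abs_self _).trans hp) ((le_abs_self _).trans happrox)

/-- Closeness of moments gives pointwise closeness: with `q` a polynomial approximation of `f`, test
with `p - q` and use the coercivity of the mass matrix on the reference triangle. -/
lemma abs_pval_sub_le_of_moments {c : ℝ} (hc : 0 < c)
    (hcoer : ∀ r : Poly 2, c * nodalNorm r ^ 2 ≤ ∫ ξ in refTri, pval r ξ * pval r ξ)
    (hf : ContinuousOn f (M.cell j)) (hE : 0 ≤ E) (hq : ∀ x ∈ M.cell j, |f x - pval q x| ≤ B)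
    (hp : ∀ Ψ : Poly 2, |(∫ x in M.cell j, pval p x * pval Ψ x) - ∫ x in M.cell j, f x * pval Ψ x|
      ≤ E * (|(M.cellLin j).det| * nodalNorm (pullback (M.vert j 0) (M.cellLin j) Ψ)))
    {x : Plane} (hx : x ∈ M.cell j) :
    |pval p x - f x| ≤ lebesgueConst * ((E + B * lebesgueConst * volume.real refTri) / c) + B := by
  have hB : 0 ≤ B := (abs_nonneg _).trans (hq x hx)
  have hlebesgue := lebesgueConst_pos
  have hpoint := abs_pval_le_nodalNorm_pullback (p - q) hx
  have hint := integral_pval_sub_mul_self_le hf hq (hp (p - q))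
  have hcoer' := hcoer (pullback (M.vert j 0) (M.cellLin j) (p - q))
  simp only [pval_pullback] at hcoer'
  rw [M.setIntegral_cell] at hint
  set m := nodalNorm (pullback (M.vert j 0) (M.cellLin j) (p - q))
  have hm0 : 0 ≤ m := nodalNorm_nonneg _
  have hquad : m * (c * m) ≤ m * (E + B * lebesgueConst * volume.real refTri) := by
    refine le_of_mul_le_mul_left ?_ (TriMesh.abs_det_cellLin_pos (M := M) (j := j))
    linarith [mul_le_mul_of_nonneg_left hcoer' (abs_nonneg (M.cellLin j).det)]
  have hnodal : m ≤ (E + B * lebesgueConst * volume.real refTri) / c := by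
    rw [le_div_iff₀' hc]
    rcases hm0.eq_or_lt with h0 | hpos
    · rw [← h0, mul_zero]; positivity
    · exact le_of_mul_le_mul_left hquad hpos
  have hsub : pval p x - f x = pval (p - q) x - (f x - pval q x) := by rw [pval_sub]; ring
  calc |pval p x - f x| ≤ |pval (p - q) x| + |f x - pval q x| := hsub ▸ abs_sub _ _
    _ ≤ lebesgueConst * m + B := add_le_add hpoint (hq x hx)
    _ ≤ _ := by gcongr

end Moments

lemma CellStep.exists_cellError_le {S : Set (Plane × ℝ)} {A : Plane × ℝ → Plane}
    {u : Plane × ℝ → ℝ} {C σ : ℝ} (hD : TransportBounds S A u C) (hσ : 0 < σ) (c e C₀ : ℝ) :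
    ∃ B, 0 < B ∧ ∀ (P : CellStep S A C c e) (v : P.M.DGSpace 2) (p : Poly 2),
      P.M.IsQuasiUniform σ → upstream P.M P.Φ P.j ⊆ P.M.region →
      (∀ l, cellError P.M l (v l) (fun x => u (x, P.s)) ≤ ENNReal.ofReal (C₀ * P.M.size ^ 3)) →
      IsUpdate P.M P.Φ v P.j p →
      cellError P.M P.j p (fun x => u (x, P.t)) ≤ ENNReal.ofReal (B * P.M.size ^ 3) := by
  have hu : ContinuousOn u S := fun x hx =>
    (hD.solution.differentiableAt x hx).continuousAt.continuousWithinAt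
  obtain ⟨K, hK⟩ := exists_consistency hD c e
  obtain ⟨k, hk, hcoer⟩ := exists_coercivity
  have hlebesgue := lebesgueConst_pos
  have hC := zero_le_one.trans hD.one_le
  set R := ((8 + 1) / σ) ^ 2 * ((√7 + 2) * lebesgueConst * (|C₀| * √Real.pi))
    * (volume.real refTri / (Real.pi * σ ^ 2)) with hR
  set B := lebesgueConst * ((R + |K| + C * lebesgueConst * volume.real refTri) / k) + C with hB
  have hB0 : 0 < B := add_pos_of_nonneg_of_pos (by positivity) (zero_lt_one.trans_le hD.one_le)
  refine ⟨B * √Real.pi, by positivity, fun P v p hM hsub hv hp => ?_⟩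
  obtain ⟨fit, hfit⟩ := P.traced.unisolvent.exists_fit
  obtain ⟨q, hq⟩ := hD.solution.exists_abs_sub_pval_le P.cell_subset
  have hcont : ContinuousOn (fun x => u (x, P.t)) (P.M.cell P.j) :=
    hu.comp (f := fun x : Plane => (x, P.t)) (by fun_prop) fun x hx => P.cell_subset ⟨hx, rfl⟩
  have hmoment (Ψ : Poly 2) : |(∫ x in P.M.cell P.j, pval p x * pval Ψ x)
        - ∫ x in P.M.cell P.j, u (x, P.t) * pval Ψ x|
      ≤ (R + |K|) * P.M.size ^ 2 * (|(P.M.cellLin P.j).det|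
        * nodalNorm (pullback (P.M.vert P.j 0) (P.M.cellLin P.j) Ψ)) := by
    have hΨ := (hfit Ψ _).2 rfl
    rw [hp Ψ _ hΨ]
    refine (abs_sub_le _ _ _).trans ((add_le_add
      (P.abs_remapIntegral_sub_le hD.velocity hu hσ hM hsub hv hΨ) ((hK P Ψ _ hΨ).trans
        (mul_le_mul_of_nonneg_right (le_abs_self K) ?_))).trans_eq ?_)
    · have := nodalNorm_nonneg (pullback P.base.1 P.lin Ψ)
      positivity
    · rw [hR, size, lin, base]; ring
  have hpoint (x : Plane) (hx : x ∈ P.M.cell P.j) : |pval p x - u (x, P.t)| ≤ B * P.M.size ^ 2 :=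
    (abs_pval_sub_le_of_moments hk hcoer hcont (by positivity) hq hmoment hx).trans_eq
      (by rw [hB]; ring)
  refine (TriMesh.cellError_le (by positivity) hpoint).trans_eq ?_
  congr 1; ring

lemma exists_forall_size_le (c C e : ℝ) : ∃ h₀, 0 < h₀ ∧ ∀ h, 0 ≤ h → h ≤ h₀ →
    h ≤ 1 ∧ 2 * (c * h * C) ≤ 1 ∧ 2 * (lebesgueConst * (e * h ^ 2)) ≤ 1 := by
  have hsmall {f : ℝ → ℝ} (hf : Continuous f) (h0 : f 0 < 1) : ∀ᶠ h in nhds 0, f h ≤ 1 :=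
    (hf.tendsto 0).eventually_le_const h0
  obtain ⟨r, hr, hball⟩ := Metric.eventually_nhds_iff_ball.1
    ((hsmall continuous_id (by simp)).and <| (hsmall (f := fun h => 2 * (c * h * C)) (by fun_prop)
      (by simp)).and (hsmall (f := fun h => 2 * (lebesgueConst * (e * h ^ 2))) (by fun_prop)
      (by simp)))
  exact ⟨r / 2, half_pos hr, fun h hh hle => hball h (by
    rw [Metric.mem_ball, Real.dist_0_eq_abs, abs_of_nonneg hh]; linarith)⟩

end SLDG

end

theorem theorem4p5_general (Ω : Set SLDG.Plane) (hΩ : Bornology.IsBounded Ω) (T : ℝ)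
    (a b u : SLDG.Plane × ℝ → ℝ) (ha : SLDG.ContDiffOnCylinder 2 Ω T a)
    (hb : SLDG.ContDiffOnCylinder 2 Ω T b) (hu : SLDG.ContDiffOnCylinder 2 Ω T u)
    (hpde : SLDG.SolvesTransport Ω T a b u) (σ c κ C₀ : ℝ) (hσ : 0 < σ) :
    ∃ C h₀ : ℝ, 0 < C ∧ 0 < h₀ ∧
      ∀ (J : ℕ) (M : SLDG.TriMesh J) (tₙ Δt : ℝ) (Φ : SLDG.Plane → SLDG.Plane)
        (uₙ : M.DGSpace 2),
        M.region ⊆ closure Ω → M.IsQuasiUniform σ → M.size ≤ h₀ →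
        0 ≤ Δt → Δt ≤ c * M.size → 0 ≤ tₙ → tₙ + Δt ≤ T →
        SLDG.TracingAccurate M Ω a b tₙ (tₙ + Δt) κ Φ →
        (∀ l, SLDG.cellError M l (uₙ l) (fun x => u (x, tₙ)) ≤
          ENNReal.ofReal (C₀ * M.size ^ 3)) →
        ∃ uNew : M.DGSpace 2, ∀ j, SLDG.UpstreamInside M Ω a b tₙ (tₙ + Δt) Φ j →
          (∀ p : SLDG.Poly 2, SLDG.IsUpdate M Φ uₙ j p ↔ p = uNew j) ∧
          SLDG.cellError M j (uNew j) (fun x => u (x, tₙ + Δt)) ≤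
            ENNReal.ofReal (C * M.size ^ 3) := by
  obtain ⟨K, hD⟩ := SLDG.exists_transportBounds hΩ ha hb hu hpde
  have hK := zero_le_one.trans hD.one_le
  set e := 4 / σ * SLDG.tracingConst K c κ
  obtain ⟨C, hC, herror⟩ := SLDG.CellStep.exists_cellError_le hD hσ c e C₀
  obtain ⟨h₀, hh₀, hsmall⟩ := SLDG.exists_forall_size_le c K e
  refine ⟨C, h₀, hC, hh₀, fun J M s Δ Φ v hregion hM hsize hΔ hΔc hs hT htr hv => ?_⟩
  obtain ⟨hsize1, hΔK, hε⟩ := hsmall _ M.size_nonneg hsize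
  have hst : s ≤ s + Δ := le_add_of_nonneg_right hΔ
  have hlag : s + Δ - s ≤ c * M.size := by rwa [add_sub_cancel_left]
  have hlagK : 2 * ((s + Δ - s) * K) ≤ 1 := by
    linarith [mul_le_mul_of_nonneg_right hlag hK]
  have hstep (j : Fin J) (hin : SLDG.UpstreamInside M Ω a b s (s + Δ) Φ j) :
      ∃ p, (∀ p', SLDG.IsUpdate M Φ v j p' ↔ p' = p) ∧
        SLDG.cellError M j p (fun x => u (x, s + Δ)) ≤ ENNReal.ofReal (C * M.size ^ 3) := by
    have hcell : M.cell j ⊆ closure Ω := (subset_iUnion M.cell j).trans hregion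
    obtain ⟨ρ, hρ⟩ := htr.exists_traced hD.velocity hD.one_le
      (prod_mono subset_rfl (Icc_subset_Icc hs hT)) hcell hst hlag hin.1 hσ hM hlagK hε
    obtain ⟨p, hp⟩ := hρ.unisolvent.exists_update v
    exact ⟨p, hp, herror ⟨J, M, j, s, s + Δ, Φ, ρ,
      prod_mono hcell (singleton_subset_iff.2 ⟨hs.trans hst, hT⟩),
      prod_mono (hin.2.trans hregion) (singleton_subset_iff.2 ⟨hs, hst.trans hT⟩),
      hst, hlag, hsize1, hlagK, hρ⟩ v p hM hin.2 hv ((hp p).2 rfl)⟩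
  choose! uNew hNew using hstep
  exact ⟨uNew, hNew⟩

theorem theorem4p5 (Ω : Set SLDG.Plane) (hΩ : IsOpen Ω) (hΩb : Bornology.IsBounded Ω) (T : ℝ)
    (a b u : SLDG.Plane × ℝ → ℝ)
    (ha : SLDG.SmoothOnCylinder Ω T a) (hb : SLDG.SmoothOnCylinder Ω T b)
    (hu : SLDG.SmoothOnCylinder Ω T u) (hpde : SLDG.SolvesTransport Ω T a b u)
    (σ c₁ c₂ κ C₀ : ℝ) (hσ : 0 < σ) (hc₁ : 0 < c₁) :
    ∃ C h₀ : ℝ, 0 < C ∧ 0 < h₀ ∧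
      ∀ (J : ℕ) (M : SLDG.TriMesh J) (tₙ Δt : ℝ) (Φ : SLDG.Plane → SLDG.Plane)
        (uₙ : M.DGSpace 2),
        M.region ⊆ closure Ω → M.IsQuasiUniform σ → M.size ≤ h₀ →
        c₁ * M.size ≤ Δt → Δt ≤ c₂ * M.size → 0 ≤ tₙ → tₙ + Δt ≤ T →
        SLDG.TracingAccurate M Ω a b tₙ (tₙ + Δt) κ Φ →
        (∀ l, SLDG.cellError M l (uₙ l) (fun x => u (x, tₙ)) ≤
          ENNReal.ofReal (C₀ * M.size ^ 3)) →
        ∃ uNew : M.DGSpace 2, ∀ j, SLDG.UpstreamInside M Ω a b tₙ (tₙ + Δt) Φ j →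
          (∀ p : SLDG.Poly 2, SLDG.IsUpdate M Φ uₙ j p ↔ p = uNew j) ∧
          SLDG.cellError M j (uNew j) (fun x => u (x, tₙ + Δt)) ≤
            ENNReal.ofReal (C * M.size ^ 3) := by
  obtain ⟨C, h₀, hC, hh₀, herror⟩ := theorem4p5_general Ω hΩb T a b u (ha.contDiffOnCylinder 2)
    (hb.contDiffOnCylinder 2) (hu.contDiffOnCylinder 2) hpde σ c₂ κ C₀ hσ
  exact ⟨C, h₀, hC, hh₀, fun J M s Δ Φ v hregion hM hsize hΔ =>
    herror J M s Δ Φ v hregion hM hsize ((mul_nonneg hc₁.le M.size_nonneg).trans hΔ)⟩
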